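/- **Theorem 2.1.** Throughout, algebras are associative and unital, and subalgebras contain the unit of the algebra. For a field $F$, an $F$-algebra $A$ is *central* if its centre equals $F$; it is *locally finite-dimensional* (LFD) if every finite subset of $A$ generates a finite-dimensional $F$-subalgebra; and it is *normally locally finite* (NLF) if every finite subset of $A$ is contained in a finite-dimensional central $F$-subalgebra of $A$. Let $K_0$ be an algebraically closed field, $K_\infty/K_0$ a purely transcendental field extension of infinite (not necessarily countable) transcendence degree, $K/K_\infty$ a finite field extension, and $p$ a prime number with $p \neq \operatorname{char}(K_0)$. Then there exists a central division LFD-algebra $R$ over $K$ with the following properties: (a) The dimension $[R : K]$ is countably infinite, and every finite-dimensional $K$-subalgebra of $R$ has dimension $p^n$ over $K$ for some integer $n \ge 0$. (b) The only finite-dimensional central $K$-subalgebra of $R$ is $K$ itself; in particular, $R$ is not an NLF-algebra over $K$. (Thus Köthe's question, whether every central division LFD-algebra over a field is NLF, has a negative answer.) -/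

import Mathlib

universe u v w

/-- The field extension `E/F` is purely transcendental: `E` is generated, as a field extension
of `F`, by a set of elements that is algebraically independent over `F`. -/
def IsPurelyTranscendental (F E : Type*) [Field F] [Field E] [Algebra F E] : Prop :=
  ∃ s : Set E, AlgebraicIndepOn F id s ∧ IntermediateField.adjoin F s = ⊤

/-- A unital `F`-algebra is locally finite-dimensional (LFD) if each finite subset generates a
finite-dimensional `F`-subalgebra. -/
def IsLFDAlgebra (F A : Type*) [Field F] [Ring A] [Algebra F A] : Prop :=
  ∀ Y : Finset A, FiniteDimensional F (Algebra.adjoin F (Y : Set A))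

/-- A unital `F`-algebra is normally locally finite (NLF) if each finite subset is included in a
finite-dimensional central (unital) `F`-subalgebra. -/
def IsNLFAlgebra (F A : Type*) [Field F] [Ring A] [Algebra F A] : Prop :=
  ∀ Y : Finset A, ∃ B : Subalgebra F A,
    (Y : Set A) ⊆ B ∧ FiniteDimensional F B ∧ Algebra.IsCentral F B

set_option linter.unusedSectionVars false

/-! ### Dominant terms of sums of Hahn series -/

open HahnSeries Module

/-! The field `K` is rewritten as `L(t₀, t₁, …)` with `L` containing `K₀`, hence all `p`-power roots
of unity. The algebra `R` is generated over `K` by elements `yᵢ` with `yᵢ ^ (p ^ i) = tᵢ` and `yᵢ₊₁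
yᵢ = ζᵢ yᵢ yᵢ₊₁`, where `ζᵢ` is a primitive `p ^ i`-th root of unity and all other pairs commute.
Its monomials form a `K`-basis indexed by `Γ ⧸ N`, the direct sum of the groups `ℤ / p ^ i`.

To control arbitrary elements, `K` is embedded in the Hahn series over `L` with exponents in `Γ`,
and `R` is realised by twisted monomial operators on them (`HahnTwist.model`). Evaluation at `1`
gives a valuation on `R`, and the class modulo `N` of the value of an element behaves like a degree.
The commutator of two leading terms is governed by the pairing `χ γ δ / χ δ γ` on `Γ ⧸ N`.

This pairing is nondegenerate on the whole group (`LexExp.exists_twist_ne`), so `R` is central. It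
is degenerate on every nontrivial finite subgroup (`LexExp.exists_radical`), because coordinates `i
+ 1` and `i` are paired through a root of order only `p ^ i`, one factor `p` short of the modulus of
coordinate `i + 1`.

The classes of a finite-dimensional subalgebra `A` form a finite subgroup of order `dim A`, a power
of `p`. If it is nontrivial, take `x` in `A` with nonzero class in the radical. Averaging `x` over
dual bases of the trace form yields an element of the centre of `A` with the same value as `x`
(`val_casimir`), since `dim A` is invertible in `L`. Its class is nonzero, so it is not a scalar and
`A` is not central. -/

theorem HahnSeries.lt_orderTop_sum {Γ L ι : Type*} [LinearOrder Γ] [AddCommGroup L]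
    {s : Finset ι} {x : ι → HahnSeries Γ L} {g : WithTop Γ} (hg : g ≠ ⊤)
    (h : ∀ i ∈ s, g < (x i).orderTop) : g < (∑ i ∈ s, x i).orderTop := by
  classical
  induction s using Finset.induction_on with
  | empty => simpa using lt_top_iff_ne_top.2 hg
  | insert a s ha ih =>
    rw [Finset.sum_insert ha]
    refine lt_of_lt_of_le (lt_min (h a (by simp)) (ih fun i hi => h i (by simp [hi]))) ?_
    exact min_orderTop_le_orderTop_add

/-- A finite sum of nonzero Hahn series of pairwise distinct orders has a dominating term. -/
theorem HahnSeries.exists_dominant_of_injOn {Γ L ι : Type*} [LinearOrder Γ] [AddCommGroup L]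
    {s : Finset ι} {x : ι → HahnSeries Γ L} (hs : s.Nonempty) (hx : ∀ i ∈ s, x i ≠ 0)
    (hinj : Set.InjOn (fun i => (x i).orderTop) s) :
    ∃ i ∈ s, (∑ j ∈ s, x j).orderTop = (x i).orderTop ∧
      (∑ j ∈ s, x j).leadingCoeff = (x i).leadingCoeff ∧
      ∀ j ∈ s, j ≠ i → (x i).orderTop < (x j).orderTop := by
  classical
  obtain ⟨i, hi, hmin⟩ := s.exists_min_image (fun i => (x i).orderTop) hs
  have hlt : ∀ j ∈ s, j ≠ i → (x i).orderTop < (x j).orderTop := fun j hj hji =>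
    lt_of_le_of_ne (hmin j hj) fun h => hji (hinj hj hi h.symm)
  have hrest : (x i).orderTop < (∑ j ∈ s.erase i, x j).orderTop :=
    lt_orderTop_sum (orderTop_ne_top.2 (hx i hi)) fun j hj =>
      hlt j (Finset.mem_of_mem_erase hj) (Finset.ne_of_mem_erase hj)
  refine ⟨i, hi, ?_, ?_, hlt⟩
  · rw [← Finset.add_sum_erase s x hi, orderTop_add_eq_left hrest]
  · rw [← Finset.add_sum_erase s x hi, leadingCoeff_add_eq_left hrest]

/-! ### Twisted models: values, classes and the trace -/

/-- An algebra `R` over `K` with a basis indexed by `Γ ⧸ N`, multiplied like a twisted group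
algebra, together with an additive embedding into Hahn series for which orders are additive and
leading coefficients are multiplicative up to the twist `χ`. -/
structure TwistedModel (Γ L K R : Type*) [AddCommGroup Γ] [LinearOrder Γ]
    [Field L] [Field K] [Ring R] [Algebra K R] (N : AddSubgroup Γ) (χ : Γ → Γ → L) where
  ev : R →+ HahnSeries Γ L
  ev_injective : Function.Injective ev
  basis : Basis (Γ ⧸ N) K R
  basis_zero : basis 0 = 1
  basis_mul : ∀ c d, ∃ k : K, basis c * basis d = k • basis (c + d)
  basis_mul_neg : ∀ c, basis c * basis (-c) = basis (-c) * basis c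
  order_ev_smul_basis : ∀ k : K, k ≠ 0 → ∀ c, ((ev (k • basis c)).order : Γ ⧸ N) = c
  orderTop_ev_mul : ∀ f g, (ev (f * g)).orderTop = (ev f).orderTop + (ev g).orderTop
  leadingCoeff_ev_mul : ∀ f g, f ≠ 0 → g ≠ 0 → (ev (f * g)).leadingCoeff =
    χ (ev f).order (ev g).order * ((ev f).leadingCoeff * (ev g).leadingCoeff)

namespace TwistedModel

variable {Γ L K R : Type*} [AddCommGroup Γ] [LinearOrder Γ] [IsOrderedAddMonoid Γ]
    [Field L] [Field K] [Ring R] [Algebra K R] {N : AddSubgroup Γ} {χ : Γ → Γ → L}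
    (M : TwistedModel Γ L K R N χ)

/-- The value of an element. -/
noncomputable def val (f : R) : WithTop Γ := (M.ev f).orderTop

/-- The class of the order of an element modulo `N`. -/
noncomputable def cls (f : R) : Γ ⧸ N := ((M.ev f).order : Γ ⧸ N)

theorem ev_ne_zero {f : R} (hf : f ≠ 0) : M.ev f ≠ 0 := fun h =>
  hf (M.ev_injective (by rw [h, map_zero]))

theorem val_eq_top {f : R} : M.val f = ⊤ ↔ f = 0 := by
  rw [val, orderTop_eq_top]
  exact ⟨fun h => M.ev_injective (by rw [h, map_zero]), fun h => by rw [h, map_zero]⟩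

theorem val_of_ne_zero {f : R} (hf : f ≠ 0) : M.val f = ((M.ev f).order : Γ) :=
  (order_eq_orderTop_of_ne_zero (M.ev_ne_zero hf)).symm

theorem val_mul (f g : R) : M.val (f * g) = M.val f + M.val g := M.orderTop_ev_mul f g

theorem cls_eq_of_val_eq {f g : R} (hf : f ≠ 0) (h : M.val f = M.val g) :
    M.cls f = M.cls g := by
  have hg : g ≠ 0 := by
    rintro rfl
    rw [M.val_eq_top.2 rfl, M.val_eq_top] at h
    exact hf h
  rw [M.val_of_ne_zero hf, M.val_of_ne_zero hg, WithTop.coe_inj] at h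
  rw [cls, cls, h]

-- Values add under multiplication, and only zero has value `⊤`.
include M in
theorem noZeroDivisors : NoZeroDivisors R where
  eq_zero_or_eq_zero_of_mul_eq_zero {f g} h := by
    rw [← M.val_eq_top, M.val_mul, WithTop.add_eq_top, M.val_eq_top, M.val_eq_top] at h
    exact h

include M in
theorem nontrivial : Nontrivial R := M.basis.repr.toEquiv.nontrivial

include M in
theorem isDomain : IsDomain R :=
  have := M.noZeroDivisors
  have := M.nontrivial
  NoZeroDivisors.to_isDomain R

theorem cls_mul {f g : R} (hf : f ≠ 0) (hg : g ≠ 0) : M.cls (f * g) = M.cls f + M.cls g := by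
  have := M.noZeroDivisors
  have h := M.val_mul f g
  rw [M.val_of_ne_zero hf, M.val_of_ne_zero hg, M.val_of_ne_zero (mul_ne_zero hf hg),
    ← WithTop.coe_add, WithTop.coe_inj] at h
  rw [cls, h]
  rfl

theorem val_one : M.val 1 = 0 := by
  have := M.nontrivial
  have h := M.val_mul 1 1
  rw [one_mul, M.val_of_ne_zero one_ne_zero, ← WithTop.coe_add, WithTop.coe_inj] at h
  rw [M.val_of_ne_zero one_ne_zero, left_eq_add.1 h, WithTop.coe_zero]

theorem cls_smul_basis {k : K} (hk : k ≠ 0) (c : Γ ⧸ N) : M.cls (k • M.basis c) = c :=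
  M.order_ev_smul_basis k hk c

theorem cls_algebraMap {k : K} (hk : k ≠ 0) : M.cls (algebraMap K R k) = 0 := by
  rw [Algebra.algebraMap_eq_smul_one, ← M.basis_zero, M.cls_smul_basis hk]

theorem cls_one : M.cls 1 = 0 := by
  simpa using M.cls_algebraMap (one_ne_zero (α := K))

theorem cls_smul {k : K} (hk : k ≠ 0) {f : R} (hf : f ≠ 0) : M.cls (k • f) = M.cls f := by
  have := M.nontrivial
  rw [Algebra.smul_def, M.cls_mul _ hf, M.cls_algebraMap hk, zero_add]
  simpa using hk

theorem val_sub_lt {f : R} {g : R} {v : WithTop Γ} (hf : v < M.val f) (hg : v < M.val g) :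
    v < M.val (f - g) := by
  rw [val, map_sub]
  exact lt_of_lt_of_le (lt_min hf hg) min_orderTop_le_orderTop_sub

theorem val_sum_lt {ι : Type*} {s : Finset ι} {x : ι → R} {v : WithTop Γ} (hv : v ≠ ⊤)
    (h : ∀ i ∈ s, v < M.val (x i)) : v < M.val (∑ i ∈ s, x i) := by
  rw [val, map_sum]
  exact lt_orderTop_sum hv h

/-- Among nonzero elements of distinct classes there is a dominating one. -/
theorem exists_dominant {ι : Type*} {s : Finset ι} {x : ι → R} (hs : s.Nonempty)
    (hx : ∀ i ∈ s, x i ≠ 0) (hinj : Set.InjOn (fun i => M.cls (x i)) s) :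
    ∃ i ∈ s, M.val (∑ j ∈ s, x j) = M.val (x i) ∧
      ∀ j ∈ s, j ≠ i → M.val (x i) < M.val (x j) := by
  obtain ⟨i, hi, h1, -, h2⟩ := exists_dominant_of_injOn (x := fun i => M.ev (x i)) hs
    (fun i hi => M.ev_ne_zero (hx i hi))
    (fun i hi j hj h => hinj hi hj (M.cls_eq_of_val_eq (hx i hi) h))
  exact ⟨i, hi, by rw [val, map_sum]; exact h1, h2⟩

/-- The terms of the basis expansion have pairwise distinct classes, so nothing cancels to leading
order; the dominating index must then be the class of `f`. -/
theorem exists_dominant_repr {f : R} (hf : f ≠ 0) :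
    M.basis.repr f (M.cls f) ≠ 0 ∧
    M.val f = M.val (M.basis.repr f (M.cls f) • M.basis (M.cls f)) ∧
    ∀ c, c ≠ M.cls f → M.val f < M.val (M.basis.repr f c • M.basis c) := by
  have hsum : ∑ c ∈ (M.basis.repr f).support, M.basis.repr f c • M.basis c = f :=
    M.basis.linearCombination_repr f
  have hne : ∀ c, M.basis.repr f c ≠ 0 → M.basis.repr f c • M.basis c ≠ 0 := fun c hc =>
    smul_ne_zero hc (M.basis.ne_zero c)
  obtain ⟨i, hi, h1, h2⟩ := M.exists_dominant (s := (M.basis.repr f).support)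
    (x := fun c => M.basis.repr f c • M.basis c)
    (by simpa [Finsupp.support_nonempty_iff] using hf)
    (fun c hc => hne c (by simpa using hc))
    (fun c hc d hd h => by
      simp only [Finset.mem_coe, Finsupp.mem_support_iff] at hc hd
      simpa [M.cls_smul_basis hc, M.cls_smul_basis hd] using h)
  rw [hsum] at h1
  rw [Finsupp.mem_support_iff] at hi
  have hci : M.cls f = i := by
    rw [M.cls_eq_of_val_eq hf h1, M.cls_smul_basis hi]
  rw [hci]
  refine ⟨hi, h1, fun c hc => ?_⟩
  rw [h1]
  by_cases h0 : M.basis.repr f c = 0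
  · rw [h0, zero_smul, M.val_eq_top.2 rfl, lt_top_iff_ne_top, Ne, M.val_eq_top]
    exact hne i hi
  · exact h2 c (by simpa using h0) hc

/-- The coefficient at the identity. -/
noncomputable def trace : R →ₗ[K] K := M.basis.coord 0

theorem trace_one : M.trace 1 = 1 := by
  rw [trace, ← M.basis_zero]; simp

theorem trace_ne_zero {f : R} (hf : f ≠ 0) (h : M.cls f = 0) : M.trace f ≠ 0 := by
  simpa [trace, h] using (M.exists_dominant_repr hf).1

theorem val_trace_of_cls_eq_zero {f : R} (hf : f ≠ 0) (h : M.cls f = 0) :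
    M.val (algebraMap K R (M.trace f)) = M.val f := by
  have := (M.exists_dominant_repr hf).2.1
  rw [this, h, M.basis_zero, Algebra.algebraMap_eq_smul_one]
  rfl

theorem val_lt_val_trace {f : R} (h : M.cls f ≠ 0) (hf : f ≠ 0) :
    M.val f < M.val (algebraMap K R (M.trace f)) := by
  have := (M.exists_dominant_repr hf).2.2 0 h.symm
  rwa [M.basis_zero, ← Algebra.algebraMap_eq_smul_one] at this

/-- A product of basis elements can have nonzero trace only when the indices are opposite, and
opposite basis elements commute. -/
theorem trace_mul_comm (f g : R) : M.trace (f * g) = M.trace (g * f) := by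
  have key : (LinearMap.mul K R).compr₂ M.trace = (LinearMap.mul K R).flip.compr₂ M.trace := by
    refine M.basis.ext fun c => M.basis.ext fun d => ?_
    simp only [LinearMap.compr₂_apply, LinearMap.mul_apply', LinearMap.flip_apply]
    by_cases h : d = -c
    · rw [h, M.basis_mul_neg]
    · obtain ⟨k, hk⟩ := M.basis_mul c d
      obtain ⟨l, hl⟩ := M.basis_mul d c
      have h1 : c + d ≠ 0 := fun h' => h (eq_neg_of_add_eq_zero_right h')
      rw [hk, hl, add_comm d c]
      simp [trace, h1]
  exact LinearMap.congr_fun₂ key f g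

/-! ### Classes of a subspace and its dimension -/

/-- The classes of the nonzero elements of a subspace. -/
def classes (A : Submodule K R) : Set (Γ ⧸ N) := {c | ∃ a ∈ A, a ≠ 0 ∧ M.cls a = c}

theorem linearIndependent_of_cls {ι : Type*} {a : ι → R} (ha : ∀ i, a i ≠ 0)
    (hinj : Function.Injective fun i => M.cls (a i)) : LinearIndependent K a := by
  classical
  rw [linearIndependent_iff']
  intro s g hg i hi
  by_contra hgi
  have hsum : ∑ j ∈ s with g j ≠ 0, g j • a j = 0 := by
    rw [Finset.sum_filter_of_ne, hg]
    rintro j - h h0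
    exact h (by rw [h0, zero_smul])
  have hne : ∀ j ∈ s.filter (fun j => g j ≠ 0), g j • a j ≠ 0 := fun j hj =>
    smul_ne_zero (Finset.mem_filter.1 hj).2 (ha j)
  obtain ⟨j, hj, h1, -⟩ := M.exists_dominant (s := s.filter (fun j => g j ≠ 0))
    (x := fun j => g j • a j) ⟨i, by simp [hi, hgi]⟩ hne
    (fun j hj l hl h => by
      simp only [Finset.coe_filter, Set.mem_ofPred_eq] at hj hl
      apply hinj
      simpa [M.cls_smul hj.2 (ha j), M.cls_smul hl.2 (ha l)] using h)
  rw [hsum, M.val_eq_top.2 rfl, eq_comm, M.val_eq_top] at h1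
  exact hne j hj h1

/-- A chosen element of each class. -/
noncomputable def rep (A : Submodule K R) (c : M.classes A) : A :=
  ⟨c.2.choose, c.2.choose_spec.1⟩

theorem rep_ne_zero (A : Submodule K R) (c : M.classes A) : (M.rep A c : R) ≠ 0 :=
  c.2.choose_spec.2.1

theorem cls_rep (A : Submodule K R) (c : M.classes A) : M.cls (M.rep A c : R) = c :=
  c.2.choose_spec.2.2

theorem linearIndependent_rep (A : Submodule K R) : LinearIndependent K (M.rep A) := by
  refine LinearIndependent.of_comp A.subtype (M.linearIndependent_of_cls (M.rep_ne_zero A) ?_)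
  intro c d h
  simp only [Function.comp_apply, Submodule.subtype_apply, M.cls_rep] at h
  exact Subtype.ext h

instance finite_classes (A : Submodule K R) [FiniteDimensional K A] : Finite (M.classes A) :=
  (M.linearIndependent_rep A).finite

/-- Elements of distinct classes are independent, which gives one inequality. -/
theorem card_classes (A : Submodule K R) [FiniteDimensional K A] :
    Nat.card (M.classes A) = finrank K A := by
  have := Fintype.ofFinite (M.classes A)
  rw [Nat.card_eq_fintype_card]
  refine le_antisymm (M.linearIndependent_rep A).fintype_card_le_finrank ?_
  -- For the other inequality, restrict coordinates to the classes of `A`: a nonzero element has a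
  -- nonzero coordinate at its own class, so this map is injective.
  let φ : A →ₗ[K] (M.classes A → K) :=
    LinearMap.pi fun c => M.basis.coord (c : Γ ⧸ N) ∘ₗ A.subtype
  have hφ : Function.Injective φ := by
    rw [injective_iff_map_eq_zero]
    intro a ha
    by_contra h0
    have h0' : (a : R) ≠ 0 := by simpa using h0
    exact (M.exists_dominant_repr h0').1 (congrFun ha ⟨M.cls (a : R), a, a.2, h0', rfl⟩)
  simpa using LinearMap.finrank_le_finrank_of_injective hφ

/-- The basis of a finite-dimensional subspace formed by elements of distinct classes. -/
noncomputable def repBasis (A : Submodule K R) [FiniteDimensional K A] :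
    Basis (M.classes A) K A :=
  have := Fintype.ofFinite (M.classes A)
  basisOfTopLeSpanOfCardEqFinrank (M.rep A)
    (((M.linearIndependent_rep A).span_eq_top_of_card_eq_finrank'
      (by rw [← Nat.card_eq_fintype_card, M.card_classes])).ge)
    (by rw [← Nat.card_eq_fintype_card, M.card_classes])

theorem repBasis_apply (A : Submodule K R) [FiniteDimensional K A] (c : M.classes A) :
    M.repBasis A c = M.rep A c := by
  simp [repBasis]

end TwistedModel

/-! ### Finite-dimensional subalgebras and their trace form -/

/-- A finite-dimensional subalgebra of a domain contains the inverses of its nonzero elements. -/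
theorem Subalgebra.exists_inverse_of_finiteDimensional {K R : Type*} [Field K] [Ring R] [IsDomain R]
    [Algebra K R] (A : Subalgebra K R) [FiniteDimensional K A] {a : R} (ha : a ∈ A) (h0 : a ≠ 0) :
    ∃ b ∈ A, a * b = 1 ∧ b * a = 1 := by
  obtain ⟨b, hb⟩ := FiniteDimensional.exists_mul_eq_one K (x := (⟨a, ha⟩ : A))
    (fun h => h0 (congrArg Subtype.val h))
  have hb' : a * b = 1 := congrArg Subtype.val hb
  refine ⟨b, b.2, hb', ?_⟩
  have : a * (b * a - 1) = 0 := by rw [mul_sub, ← mul_assoc, hb', one_mul, mul_one, sub_self]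
  exact sub_eq_zero.1 ((mul_eq_zero.1 this).resolve_left h0)

namespace TwistedModel

variable {Γ L K R : Type*} [AddCommGroup Γ] [LinearOrder Γ] [IsOrderedAddMonoid Γ]
    [Field L] [Field K] [Ring R] [Algebra K R] {N : AddSubgroup Γ} {χ : Γ → Γ → L}
    (M : TwistedModel Γ L K R N χ)

/-- The classes of the nonzero elements of a finite-dimensional subalgebra form a subgroup. -/
def classGroup (A : Subalgebra K R) [FiniteDimensional K A] : AddSubgroup (Γ ⧸ N) where
  carrier := M.classes (Subalgebra.toSubmodule A)
  zero_mem' := ⟨1, A.one_mem, (have := M.nontrivial; one_ne_zero), M.cls_one⟩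
  add_mem' := by
    rintro _ _ ⟨a, ha, ha0, rfl⟩ ⟨b, hb, hb0, rfl⟩
    have := M.noZeroDivisors
    exact ⟨a * b, A.mul_mem ha hb, mul_ne_zero ha0 hb0, M.cls_mul ha0 hb0⟩
  neg_mem' := by
    rintro _ ⟨a, ha, ha0, rfl⟩
    have := M.isDomain
    obtain ⟨b, hb, hab, -⟩ := A.exists_inverse_of_finiteDimensional ha ha0
    have hb0 : b ≠ 0 := right_ne_zero_of_mul_eq_one hab
    refine ⟨b, hb, hb0, eq_neg_of_add_eq_zero_right ?_⟩
    rw [← M.cls_mul ha0 hb0, hab, M.cls_one]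

theorem mem_classGroup {A : Subalgebra K R} [FiniteDimensional K A] {a : R} (ha : a ∈ A)
    (h0 : a ≠ 0) : M.cls a ∈ M.classGroup A := ⟨a, ha, h0, rfl⟩

instance finite_classGroup (A : Subalgebra K R) [FiniteDimensional K A] :
    Finite (M.classGroup A) :=
  M.finite_classes (Subalgebra.toSubmodule A)

theorem card_classGroup (A : Subalgebra K R) [FiniteDimensional K A] :
    Nat.card (M.classGroup A) = finrank K A :=
  M.card_classes (Subalgebra.toSubmodule A)

/-- The trace form of a finite-dimensional subalgebra. -/
noncomputable def traceForm (A : Subalgebra K R) : LinearMap.BilinForm K A :=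
  (LinearMap.mul K A).compr₂ (M.trace ∘ₗ A.val.toLinearMap)

theorem traceForm_apply (A : Subalgebra K R) (x y : A) :
    M.traceForm A x y = M.trace (x * y) := rfl

theorem isSymm_traceForm (A : Subalgebra K R) : (M.traceForm A).IsSymm :=
  ⟨fun x y => by simp [traceForm_apply, M.trace_mul_comm (x : R)]⟩

/-- A nonzero `x` has an inverse in `A`, and pairs with it to `trace 1 = 1`. -/
theorem nondegenerate_traceForm (A : Subalgebra K R) [FiniteDimensional K A] :
    (M.traceForm A).Nondegenerate := by
  have h : ∀ x : A, (∀ y, M.traceForm A x y = 0) → x = 0 := by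
    intro x hx
    by_contra h0
    have := M.isDomain
    obtain ⟨b, hb, hab, -⟩ := A.exists_inverse_of_finiteDimensional x.2 (by simpa using h0)
    have h1 := hx ⟨b, hb⟩
    rw [traceForm_apply] at h1
    simp [hab, M.trace_one] at h1
  refine ⟨h, fun y hy => h y fun x => ?_⟩
  rw [← (M.isSymm_traceForm A).eq]
  exact hy x

/-! ### Averaging over dual bases -/

section Casimir

variable (A : Subalgebra K R) [FiniteDimensional K A]

open Classical in
/-- The dual of the basis of representatives with respect to the trace form. -/
noncomputable def dualRep :
    Basis (M.classes (Subalgebra.toSubmodule A)) K A :=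
  (M.traceForm A).dualBasis (M.nondegenerate_traceForm A)
    (M.repBasis (Subalgebra.toSubmodule A) : Basis _ K A)

open Classical in
theorem trace_rep_mul_dualRep (s t : M.classes (Subalgebra.toSubmodule A)) :
    M.trace (M.rep (Subalgebra.toSubmodule A) s * (M.dualRep A t : R)) = if s = t then 1 else 0 := by
  have := (M.traceForm A).apply_dualBasis_right (M.nondegenerate_traceForm A)
    (M.isSymm_traceForm A) (M.repBasis (Subalgebra.toSubmodule A) : Basis _ K A) s t
  rw [traceForm_apply] at this
  rw [← this, ← repBasis_apply]
  rfl

theorem rep_expand (x : A) [Fintype (M.classes (Subalgebra.toSubmodule A))] :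
    (x : R) = ∑ t, M.trace (x * (M.dualRep A t : R)) •
      (M.rep (Subalgebra.toSubmodule A) t : R) := by
  classical
  have h := (M.repBasis (Subalgebra.toSubmodule A) : Basis _ K A).sum_repr x
  have h2 : ∀ t, (M.repBasis (Subalgebra.toSubmodule A) : Basis _ K A).repr x t =
      M.trace (x * (M.dualRep A t : R)) := by
    intro t
    have h3 : (x : R) = ∑ s, (M.repBasis (Subalgebra.toSubmodule A) : Basis _ K A).repr x s •
        (M.rep (Subalgebra.toSubmodule A) s : R) := by
      conv_lhs => rw [← h]
      rw [AddSubmonoidClass.coe_finsetSum]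
      exact Finset.sum_congr rfl fun s _ => by rw [← repBasis_apply]; rfl
    conv_rhs => rw [h3]
    simp [Finset.sum_mul, M.trace_rep_mul_dualRep]
  conv_lhs => rw [← h]
  rw [AddSubmonoidClass.coe_finsetSum]
  exact Finset.sum_congr rfl fun s _ => by rw [← h2, ← repBasis_apply]; rfl

theorem dualRep_expand (x : A) [Fintype (M.classes (Subalgebra.toSubmodule A))] :
    (x : R) = ∑ t, M.trace (x * (M.rep (Subalgebra.toSubmodule A) t : R)) •
      (M.dualRep A t : R) := by
  classical
  have h := (M.dualRep A).sum_repr x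
  conv_lhs => rw [← h]
  rw [AddSubmonoidClass.coe_finsetSum]
  refine Finset.sum_congr rfl fun s _ => ?_
  rw [dualRep, LinearMap.BilinForm.dualBasis_repr_apply, traceForm_apply, ← repBasis_apply]
  rfl

/-- The average of `x` over dual bases. -/
noncomputable def casimir [Fintype (M.classes (Subalgebra.toSubmodule A))] (x : R) : R :=
  ∑ s, (M.rep (Subalgebra.toSubmodule A) s : R) * x * (M.dualRep A s : R)

theorem casimir_mem [Fintype (M.classes (Subalgebra.toSubmodule A))] {x : R} (hx : x ∈ A) :
    M.casimir A x ∈ A :=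
  sum_mem fun s _ => A.mul_mem (A.mul_mem (M.rep (Subalgebra.toSubmodule A) s).2 hx)
    (M.dualRep A s).2

/-- The usual Casimir argument: left multiplication by `y` on a basis and right multiplication by
`y` on the dual basis have the same matrix coefficients, by cyclicity of the trace. -/
theorem mul_casimir [Fintype (M.classes (Subalgebra.toSubmodule A))] (x : R) {y : R} (hy : y ∈ A) :
    y * M.casimir A x = M.casimir A x * y := by
  set r := fun s => (M.rep (Subalgebra.toSubmodule A) s : R) with hr
  set d := fun s => (M.dualRep A s : R) with hd
  have h1 : ∀ s, y * r s = ∑ t, M.trace (y * r s * d t) • r t := fun s =>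
    M.rep_expand A ⟨y * r s, A.mul_mem hy (M.rep (Subalgebra.toSubmodule A) s).2⟩
  have h2 : ∀ t, d t * y = ∑ s, M.trace (d t * y * r s) • d s := fun t =>
    M.dualRep_expand A ⟨d t * y, A.mul_mem (M.dualRep A t).2 hy⟩
  calc y * M.casimir A x = ∑ s, ∑ t, M.trace (y * r s * d t) • (r t * x * d s) := by
        rw [casimir, Finset.mul_sum]
        refine Finset.sum_congr rfl fun s _ => ?_
        change y * (r s * x * d s) = _
        rw [← mul_assoc, ← mul_assoc]
        conv_lhs => rw [h1 s]
        simp only [Finset.sum_mul, smul_mul_assoc]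
    _ = ∑ t, ∑ s, M.trace (d t * y * r s) • (r t * x * d s) := by
        rw [Finset.sum_comm]
        refine Finset.sum_congr rfl fun t _ => Finset.sum_congr rfl fun s _ => ?_
        rw [M.trace_mul_comm, ← mul_assoc (d t)]
    _ = M.casimir A x * y := by
        rw [casimir, Finset.sum_mul]
        refine Finset.sum_congr rfl fun t _ => ?_
        change _ = r t * x * d t * y
        rw [mul_assoc _ (d t) y]
        conv_rhs => rw [h2 t]
        simp only [Finset.mul_sum, mul_smul_comm]

/-- Says that the dual basis element agrees with the inverse `b` of the representative to leading
order, which makes the average behave like a sum of conjugates. -/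
theorem zero_lt_val_rep_add (s : M.classes (Subalgebra.toSubmodule A)) {b : R}
    (hb : b ∈ A) (hab : (M.rep (Subalgebra.toSubmodule A) s : R) * b = 1) :
    0 < M.val (M.rep (Subalgebra.toSubmodule A) s : R) + M.val ((M.dualRep A s : R) - b) := by
  classical
  have := M.isDomain
  set e := (M.dualRep A s : R) - b with he
  have heA : e ∈ A := A.sub_mem (M.dualRep A s).2 hb
  by_cases h0 : e = 0
  · rw [h0, M.val_eq_top.2 rfl, WithTop.add_top]
    exact WithTop.coe_lt_top 0
  have hneg : -M.cls e ∈ M.classGroup A := neg_mem (M.mem_classGroup heA h0)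
  -- The representative of class opposite to the error `e`, so that the value of their product can
  -- be read off its trace.
  let t : M.classes (Subalgebra.toSubmodule A) := ⟨-M.cls e, hneg⟩
  set at' := (M.rep (Subalgebra.toSubmodule A) t : R) with hat
  have hat0 : at' ≠ 0 := M.rep_ne_zero _ t
  have hb0 : b ≠ 0 := right_ne_zero_of_mul_eq_one hab
  have hs0 := M.rep_ne_zero _ s
  have hcls : M.cls (at' * e) = 0 := by
    rw [M.cls_mul hat0 h0, hat, M.cls_rep]; exact neg_add_cancel _
  have hclsb : M.cls b = -(s : Γ ⧸ N) := by
    rw [← M.cls_rep _ s]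
    refine eq_neg_of_add_eq_zero_right ?_
    rw [← M.cls_mul hs0 hb0, hab, M.cls_one]
  have htr : M.trace (at' * e) = (if t = s then 1 else 0) - M.trace (at' * b) := by
    rw [he, mul_sub, map_sub, hat, M.trace_rep_mul_dualRep]
  have hts : t ≠ s := by
    intro hts
    apply M.trace_ne_zero (mul_ne_zero hat0 h0) hcls
    rw [htr, if_pos hts, hat, hts, hab, M.trace_one, sub_self]
  have hcls2 : M.cls (at' * b) ≠ 0 := by
    rw [M.cls_mul hat0 hb0, hclsb, hat, M.cls_rep, ← sub_eq_add_neg, sub_ne_zero]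
    exact fun h => hts (Subtype.ext h)
  -- For `t ≠ s` the traces of `at' * e` and `at' * b` are opposite. The first has the value of `at'
  -- * e`, the second a value larger than that of `at' * b`.
  have hlt := M.val_lt_val_trace hcls2 (mul_ne_zero hat0 hb0)
  have heq := M.val_trace_of_cls_eq_zero (mul_ne_zero hat0 h0) hcls
  rw [htr, if_neg hts, zero_sub, map_neg] at heq
  have hneg : M.val (-algebraMap K R (M.trace (at' * b))) =
      M.val (algebraMap K R (M.trace (at' * b))) := by
    rw [val, map_neg, orderTop_neg]; rfl
  rw [← hneg, heq, M.val_mul, M.val_mul] at hlt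
  have hinv : M.val (M.rep (Subalgebra.toSubmodule A) s : R) + M.val b = 0 := by
    rw [← M.val_mul, hab, M.val_one]
  rw [M.val_of_ne_zero hat0, M.val_of_ne_zero hb0, M.val_of_ne_zero h0, ← WithTop.coe_add,
    ← WithTop.coe_add, WithTop.coe_lt_coe] at hlt
  rw [M.val_of_ne_zero hs0, M.val_of_ne_zero hb0, ← WithTop.coe_add, ← WithTop.coe_zero,
    WithTop.coe_inj] at hinv
  rw [M.val_of_ne_zero hs0, M.val_of_ne_zero h0, ← WithTop.coe_add, ← WithTop.coe_zero,
    WithTop.coe_lt_coe, ← hinv]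
  exact add_lt_add_right (lt_of_add_lt_add_left hlt) _

/-- If the class of `x` is in the radical, then `x` is fixed up to higher order by conjugation. -/
theorem val_lt_val_comm {a x : R} (ha : a ≠ 0) (hx : x ≠ 0)
    (h : χ (M.ev a).order (M.ev x).order = χ (M.ev x).order (M.ev a).order) :
    M.val a + M.val x < M.val (a * x - x * a) := by
  have hcomm : M.val (x * a) = M.val (a * x) := by rw [M.val_mul, M.val_mul, add_comm]
  have := M.noZeroDivisors
  rw [← M.val_mul, M.val_of_ne_zero (mul_ne_zero ha hx)] at *
  rw [val, map_sub]
  refine le_orderTop_of_leadingCoeff_eq (M.val_of_ne_zero (mul_ne_zero ha hx)) hcomm ?_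
  rw [M.leadingCoeff_ev_mul _ _ ha hx, M.leadingCoeff_ev_mul _ _ hx ha, h, mul_comm (leadingCoeff _)]

/-- Each summand is `x` plus terms of higher value, so the average is `dim A` times `x` plus higher
terms, and `dim A` does not vanish in `L`. -/
theorem val_casimir [Fintype (M.classes (Subalgebra.toSubmodule A))]
    (hcard : ((finrank K A : ℕ) : L) ≠ 0) {x : R} (hx : x ≠ 0)
    (h : ∀ a ∈ A, a ≠ 0 → χ (M.ev a).order (M.ev x).order = χ (M.ev x).order (M.ev a).order) :
    M.val (M.casimir A x) = M.val x := by
  have := M.isDomain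
  have hvx : M.val x ≠ ⊤ := by rwa [Ne, M.val_eq_top]
  have hterm : ∀ s : M.classes (Subalgebra.toSubmodule A), M.val x <
      M.val ((M.rep (Subalgebra.toSubmodule A) s : R) * x * (M.dualRep A s : R) - x) := by
    intro s
    set a := (M.rep (Subalgebra.toSubmodule A) s : R) with ha
    have haA : a ∈ A := (M.rep (Subalgebra.toSubmodule A) s).2
    have ha0 : a ≠ 0 := M.rep_ne_zero _ s
    obtain ⟨b, hb, hab, -⟩ := A.exists_inverse_of_finiteDimensional haA ha0
    have hb0 : b ≠ 0 := right_ne_zero_of_mul_eq_one hab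
    have hab' : M.val a + M.val b = 0 := by rw [← M.val_mul, hab, M.val_one]
    -- The error splits into a commutator, small by the hypothesis on `χ`, and the discrepancy
    -- between dual element and inverse.
    have hsplit : a * x * (M.dualRep A s : R) - x =
        (a * x - x * a) * b - -(a * x * ((M.dualRep A s : R) - b)) := by
      rw [sub_mul, mul_assoc x a b, hab, mul_sub, mul_one, mul_assoc a x b]; abel
    rw [hsplit]
    refine M.val_sub_lt ?_ ?_
    · rw [M.val_mul]
      have h1 := M.val_lt_val_comm ha0 hx (h a haA ha0)
      calc M.val x = (M.val a + M.val x) + M.val b := by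
            rw [add_right_comm, hab', zero_add]
        _ < _ := by
            rw [M.val_of_ne_zero hb0]
            exact WithTop.add_lt_add_right WithTop.coe_ne_top h1
    · have h1 := M.zero_lt_val_rep_add A s hb hab
      have h2 : M.val (-(a * x * ((M.dualRep A s : R) - b))) =
          M.val (a * x * ((M.dualRep A s : R) - b)) := by
        rw [val, map_neg, orderTop_neg]; rfl
      rw [h2, M.val_mul, M.val_mul, add_right_comm]
      calc M.val x = 0 + M.val x := (zero_add _).symm
        _ < _ := WithTop.add_lt_add_right hvx h1
  have hsum := M.val_sum_lt (s := Finset.univ) hvx fun s _ => hterm s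
  rw [Finset.sum_sub_distrib, Finset.sum_const, Finset.card_univ, ← Nat.card_eq_fintype_card,
    M.card_classes] at hsum
  change M.val x < M.val (M.casimir A x - finrank K A • x) at hsum
  have hn : M.val (finrank K A • x) = M.val x := by
    refine le_antisymm ?_ ?_
    · have hx' := M.val_of_ne_zero hx
      rw [hx', val]
      refine orderTop_le_of_coeff_ne_zero ?_
      rw [map_nsmul, coeff_nsmul, Pi.smul_apply, nsmul_eq_mul]
      exact mul_ne_zero hcard (mt coeff_order_eq_zero.1 (M.ev_ne_zero hx))
    · rw [val, val, map_nsmul]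
      exact orderTop_le_orderTop_smul _ _
  rw [← hn] at hsum
  rw [← hn, ← add_sub_cancel (finrank K A • x) (M.casimir A x)]
  rw [val, map_add]
  exact orderTop_add_eq_left hsum

end Casimir

/-! ### Structure of a twisted model -/

include M in
/-- A finite-dimensional central subalgebra is trivial when every nontrivial finite subgroup of
`Γ ⧸ N` is degenerate for the commutator pairing of the twist. -/
theorem eq_bot_of_isCentral
    (hdeg : ∀ S : AddSubgroup (Γ ⧸ N), Finite S → S ≠ ⊥ → ∃ c ∈ S, c ≠ 0 ∧
      ∀ γ δ : Γ, (γ : Γ ⧸ N) = c → (δ : Γ ⧸ N) ∈ S → χ γ δ = χ δ γ)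
    (A : Subalgebra K R) [FiniteDimensional K A] (hcard : ((finrank K A : ℕ) : L) ≠ 0)
    (hA : Algebra.IsCentral K A) : A = ⊥ := by
  have := M.isDomain
  have : Fintype (M.classes (Subalgebra.toSubmodule A)) := Fintype.ofFinite _
  have hbot : M.classGroup A = ⊥ := by
    by_contra hne
    obtain ⟨c, ⟨x, hxA, hx, rfl⟩, hc, hrad⟩ := hdeg _ inferInstance hne
    have hval := M.val_casimir A hcard hx fun a ha ha0 =>
      (hrad _ _ rfl (M.mem_classGroup ha ha0)).symm
    have hmem := M.casimir_mem A hxA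
    have hcenter : (⟨M.casimir A x, hmem⟩ : A) ∈ Subalgebra.center K A := by
      rw [Subalgebra.mem_center_iff]
      intro y
      exact Subtype.ext (M.mul_casimir A x y.2)
    -- Centrality turns the average into a scalar, of class zero, although it has the value of `x`,
    -- of nonzero class.
    obtain ⟨k, hk⟩ := Algebra.mem_bot.1 (hA.out hcenter)
    have hk' : algebraMap K R k = M.casimir A x := congrArg Subtype.val hk
    have hcls := M.cls_eq_of_val_eq hx hval.symm
    rw [← hk'] at hcls
    apply hc
    rw [hcls]
    refine M.cls_algebraMap ?_
    rintro rfl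
    rw [← hk', map_zero, M.val_eq_top.2 rfl, eq_comm, M.val_eq_top] at hval
    exact hx hval
  have hfr := M.card_classGroup A
  rw [hbot] at hfr
  exact Subalgebra.eq_bot_of_finrank_one (by simpa using hfr.symm)

include M in
theorem exists_finrank_eq_pow {p : ℕ} (hp : p.Prime)
    (htors : ∀ c : Γ ⧸ N, ∃ k, p ^ k • c = 0)
    (A : Subalgebra K R) [FiniteDimensional K A] : ∃ n, finrank K A = p ^ n := by
  have := Fact.mk hp
  rw [← M.card_classGroup A]
  have hP : IsPGroup p (Multiplicative (M.classGroup A)) := fun g => by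
    obtain ⟨k, hk⟩ := htors (g.toAdd : Γ ⧸ N)
    exact ⟨k, Multiplicative.toAdd.injective (Subtype.ext hk)⟩
  have h := IsPGroup.iff_card.1 hP
  exact h

/-- The subalgebra spanned by the basis elements indexed by a subgroup. -/
def ofSubgroup (C : AddSubgroup (Γ ⧸ N)) : Subalgebra K R :=
  (Submodule.span K (M.basis '' C)).toSubalgebra
    (Submodule.subset_span ⟨0, C.zero_mem, M.basis_zero⟩) fun x y hx hy => by
      refine Submodule.span_induction₂ (p := fun x y _ _ => x * y ∈ _) ?_ ?_ ?_ ?_ ?_ ?_ ?_ hx hy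
      · rintro _ _ ⟨c, hc, rfl⟩ ⟨d, hd, rfl⟩
        obtain ⟨k, hk⟩ := M.basis_mul c d
        rw [hk]
        exact Submodule.smul_mem _ _ (Submodule.subset_span ⟨c + d, C.add_mem hc hd, rfl⟩)
      · intro y _; rw [zero_mul]; exact zero_mem _
      · intro x _; rw [mul_zero]; exact zero_mem _
      · intro x y z _ _ _ h1 h2; rw [add_mul]; exact add_mem h1 h2
      · intro x y z _ _ _ h1 h2; rw [mul_add]; exact add_mem h1 h2
      · intro k x y _ _ h; rw [smul_mul_assoc]; exact Submodule.smul_mem _ _ h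
      · intro k x y _ _ h; rw [mul_smul_comm]; exact Submodule.smul_mem _ _ h

theorem finiteDimensional_ofSubgroup (C : AddSubgroup (Γ ⧸ N)) [Finite C] :
    FiniteDimensional K (M.ofSubgroup C) :=
  FiniteDimensional.span_of_finite K ((Set.toFinite (C : Set (Γ ⧸ N))).image _)

-- Finitely many elements involve finitely many basis indices; these generate a finite group, being
-- torsion, and its basis elements span a subalgebra.
include M in
theorem isLFD {p : ℕ} (hp : p.Prime) (htors : ∀ c : Γ ⧸ N, ∃ k, p ^ k • c = 0) :
    IsLFDAlgebra K R := by
  classical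
  intro Y
  let T : Finset (Γ ⧸ N) := Y.biUnion fun y => (M.basis.repr y).support
  let C : AddSubgroup (Γ ⧸ N) := AddSubgroup.closure (T : Set (Γ ⧸ N))
  have hfin : Finite C := by
    have : AddGroup.FG C := AddGroup.closure_finset_fg T
    refine AddCommGroup.finite_of_fg_isAddTorsion C ?_
    intro c
    obtain ⟨k, hk⟩ := htors (c : Γ ⧸ N)
    exact isOfFinAddOrder_iff_nsmul_eq_zero.2
      ⟨p ^ k, pow_pos hp.pos k, Subtype.ext (by simpa using hk)⟩
  have := M.finiteDimensional_ofSubgroup C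
  have hle : Algebra.adjoin K (Y : Set R) ≤ M.ofSubgroup C := by
    rw [Algebra.adjoin_le_iff]
    intro y hy
    change y ∈ Submodule.span K (M.basis '' C)
    rw [← M.basis.linearCombination_repr y]
    refine Submodule.sum_mem _ fun c hc => Submodule.smul_mem _ _ (Submodule.subset_span ?_)
    exact ⟨c, AddSubgroup.subset_closure (Finset.mem_coe.2 (Finset.mem_biUnion.2 ⟨y, hy, hc⟩)), rfl⟩
  exact Submodule.finiteDimensional_of_le (S₁ := Subalgebra.toSubmodule (Algebra.adjoin K _))
    (S₂ := Subalgebra.toSubmodule (M.ofSubgroup C)) hle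

include M in
theorem isUnit_of_ne_zero {p : ℕ} (hp : p.Prime) (htors : ∀ c : Γ ⧸ N, ∃ k, p ^ k • c = 0)
    {a : R} (ha : a ≠ 0) : IsUnit a := by
  have := M.isDomain
  have := M.isLFD hp htors {a}
  obtain ⟨b, -, h1, h2⟩ := Subalgebra.exists_inverse_of_finiteDimensional
    (Algebra.adjoin K (({a} : Finset R) : Set R)) (Algebra.subset_adjoin (by simp)) ha
  exact ⟨⟨a, b, h1, h2⟩, rfl⟩

-- A central element minus its trace is central with trace zero. If nonzero, its class is nonzero,
-- and comparing leading coefficients of its two products with a suitable basis element contradicts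
-- `hχ`.
include M in
theorem isCentral (hχ : ∀ c : Γ ⧸ N, c ≠ 0 → ∃ d : Γ ⧸ N,
    ∀ γ δ : Γ, (γ : Γ ⧸ N) = c → (δ : Γ ⧸ N) = d → χ γ δ ≠ χ δ γ) : Algebra.IsCentral K R where
  out z hz := by
    rw [Subalgebra.mem_center_iff] at hz
    have := M.isDomain
    by_contra hbot
    set y := z - algebraMap K R (M.trace z) with hy
    have hy0 : y ≠ 0 := fun h => hbot (Algebra.mem_bot.2 ⟨_, (sub_eq_zero.1 h).symm⟩)
    have hyc : ∀ w, w * y = y * w := fun w => by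
      rw [hy, mul_sub, sub_mul, hz w, Algebra.commutes]
    have htr : M.trace y = 0 := by
      rw [hy, map_sub, Algebra.algebraMap_eq_smul_one, map_smul, M.trace_one]; simp
    have hcls : M.cls y ≠ 0 := fun h => M.trace_ne_zero hy0 h htr
    obtain ⟨d, hd⟩ := hχ _ hcls
    have hw0 := M.basis.ne_zero d
    have hwd : M.cls (M.basis d) = d := by
      simpa using M.cls_smul_basis (one_ne_zero (α := K)) d
    refine hd _ _ rfl hwd ?_
    have h1 := M.leadingCoeff_ev_mul _ _ hy0 hw0
    rw [← hyc, M.leadingCoeff_ev_mul _ _ hw0 hy0, mul_comm (leadingCoeff _)] at h1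
    exact (mul_right_cancel₀ (mul_ne_zero (leadingCoeff_ne_zero.2 (M.ev_ne_zero hy0))
      (leadingCoeff_ne_zero.2 (M.ev_ne_zero hw0))) h1).symm

end TwistedModel

/-! ### Twisted monomial operators on Hahn series -/

/-- A bimultiplicative map with values in a field, trivial on a subgroup in either argument. -/
structure IsTwist {Γ L : Type*} [AddCommGroup Γ] [Field L] (N : AddSubgroup Γ)
    (χ : Γ → Γ → L) : Prop where
  ne_zero : ∀ γ δ, χ γ δ ≠ 0
  add_left : ∀ γ γ' δ, χ (γ + γ') δ = χ γ δ * χ γ' δ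
  add_right : ∀ γ δ δ', χ γ (δ + δ') = χ γ δ * χ γ δ'
  left_eq_one : ∀ n ∈ N, ∀ δ, χ n δ = 1
  right_eq_one : ∀ n ∈ N, ∀ γ, χ γ n = 1

namespace IsTwist

variable {Γ L : Type*} [AddCommGroup Γ] [Field L] {N : AddSubgroup Γ} {χ : Γ → Γ → L}

/-- Modulo `N` one has `δ = -γ`, so both sides are the inverse of `χ γ γ`. -/
theorem comm_of_add_mem (hχ : IsTwist N χ) {γ δ : Γ} (h : γ + δ ∈ N) : χ γ δ = χ δ γ := by
  have h1 : χ γ δ * χ γ γ = 1 := by rw [← hχ.add_right, add_comm, hχ.right_eq_one _ h]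
  have h2 : χ δ γ * χ γ γ = 1 := by rw [← hχ.add_left, add_comm, hχ.left_eq_one _ h]
  exact mul_right_cancel₀ (hχ.ne_zero γ γ) (h1.trans h2.symm)

end IsTwist

/-- A field embedded in Hahn series with exponents in `N`, containing the monomials with exponents
in `N`. -/
structure IsMonomialField (Γ L K : Type*) [AddCommGroup Γ] [LinearOrder Γ] [IsOrderedAddMonoid Γ]
    [Field L] [Field K] [Algebra K (HahnSeries Γ L)] (N : AddSubgroup Γ) : Prop where
  support_subset : ∀ k : K, (algebraMap K (HahnSeries Γ L) k).support ⊆ N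
  exists_single : ∀ n ∈ N, ∀ l : L, ∃ k : K, algebraMap K (HahnSeries Γ L) k = single n l

namespace HahnTwist

variable {Γ L K : Type*} [AddCommGroup Γ] [LinearOrder Γ] [IsOrderedAddMonoid Γ]
    [Field L] [Field K] [Algebra K (HahnSeries Γ L)] {N : AddSubgroup Γ} {χ : Γ → Γ → L}

/-- Scaling the coefficient of exponent `δ` by `χ γ δ`. -/
def scaleFun (_hχ : IsTwist N χ) (γ : Γ) (b : HahnSeries Γ L) : HahnSeries Γ L where
  coeff δ := χ γ δ * b.coeff δ
  isPWO_support' := b.isPWO_support.mono fun δ h => by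
    simp only [Function.mem_support, ne_eq, mul_eq_zero, not_or] at h
    exact h.2

theorem coeff_scaleFun (hχ : IsTwist N χ) (γ δ : Γ) (b : HahnSeries Γ L) :
    (scaleFun hχ γ b).coeff δ = χ γ δ * b.coeff δ := rfl

theorem support_scaleFun (hχ : IsTwist N χ) (γ : Γ) (b : HahnSeries Γ L) :
    (scaleFun hχ γ b).support = b.support := by
  ext δ
  simp [mem_support, coeff_scaleFun, hχ.ne_zero]

/-- Shifting by exponents in `N` does not change `χ γ`. This makes scaling `K`-linear, and lets `R`
consist of operators, for which associativity is automatic. -/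
theorem scaleFun_mul (hχ : IsTwist N χ) (γ : Γ) {a : HahnSeries Γ L} (ha : a.support ⊆ N)
    (b : HahnSeries Γ L) : scaleFun hχ γ (a * b) = a * scaleFun hχ γ b := by
  ext δ
  rw [coeff_scaleFun, coeff_mul, coeff_mul_right' b.isPWO_support (support_scaleFun hχ γ b).le,
    Finset.mul_sum]
  refine Finset.sum_congr rfl fun ij hij => ?_
  rw [Finset.mem_antidiagonal] at hij
  rw [coeff_scaleFun, ← hij.2.2, hχ.add_right, hχ.right_eq_one _ (ha hij.1)]
  ring

theorem orderTop_scaleFun (hχ : IsTwist N χ) (γ : Γ) (b : HahnSeries Γ L) :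
    (scaleFun hχ γ b).orderTop = b.orderTop := by
  refine le_antisymm ?_ ?_ <;> rw [le_orderTop_iff_forall] <;> intro j hj
  · by_contra h
    have := coeff_eq_zero_of_lt_orderTop hj
    rw [coeff_scaleFun, mul_eq_zero] at this
    exact h (this.resolve_left (hχ.ne_zero _ _))
  · rw [coeff_scaleFun, coeff_eq_zero_of_lt_orderTop hj, mul_zero]

theorem leadingCoeff_scaleFun (hχ : IsTwist N χ) (γ : Γ) {b : HahnSeries Γ L} (hb : b ≠ 0) :
    (scaleFun hχ γ b).leadingCoeff = χ γ b.order * b.leadingCoeff := by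
  have h := orderTop_scaleFun hχ γ b
  have h0 : scaleFun hχ γ b ≠ 0 := by rwa [← orderTop_ne_top, h, orderTop_ne_top]
  rw [← order_eq_orderTop_of_ne_zero h0, ← order_eq_orderTop_of_ne_zero hb, WithTop.coe_inj] at h
  rw [leadingCoeff_eq, h, coeff_scaleFun, leadingCoeff_eq]

variable (hχ : IsTwist N χ) (hK : IsMonomialField Γ L K N)

/-- The scaling operator as a linear map. -/
def scale (γ : Γ) : End K (HahnSeries Γ L) where
  toFun := scaleFun hχ γ
  map_add' a b := by
    ext δ
    simp [coeff_scaleFun, mul_add]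
  map_smul' k b := by
    rw [Algebra.smul_def, scaleFun_mul hχ γ (hK.support_subset k), Algebra.smul_def, RingHom.id_apply]

/-- The twisted monomial operator `b ↦ x ^ γ * σ_γ b`. -/
noncomputable def mono (γ : Γ) : End K (HahnSeries Γ L) :=
  LinearMap.mulLeft K (single γ 1) * scale hχ hK γ

theorem mono_apply (γ : Γ) (b : HahnSeries Γ L) :
    mono hχ hK γ b = single γ 1 * scaleFun hχ γ b := rfl

theorem coeff_mono (γ δ : Γ) (b : HahnSeries Γ L) :
    (mono hχ hK γ b).coeff δ = χ γ (δ - γ) * b.coeff (δ - γ) := by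
  rw [mono_apply, coeff_single_mul, one_mul, coeff_scaleFun]

theorem orderTop_mono (γ : Γ) (b : HahnSeries Γ L) :
    (mono hχ hK γ b).orderTop = γ + b.orderTop := by
  rw [mono_apply, orderTop_mul, orderTop_single one_ne_zero, orderTop_scaleFun]

theorem leadingCoeff_mono (γ : Γ) {b : HahnSeries Γ L} (hb : b ≠ 0) :
    (mono hχ hK γ b).leadingCoeff = χ γ b.order * b.leadingCoeff := by
  rw [mono_apply, leadingCoeff_mul, leadingCoeff_of_single, one_mul, leadingCoeff_scaleFun hχ γ hb]

include hK in
theorem exists_order_mem {k : K} (hk : k ≠ 0) :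
    ∃ n ∈ N, (algebraMap K (HahnSeries Γ L) k).orderTop = (n : Γ) := by
  have h0 : algebraMap K (HahnSeries Γ L) k ≠ 0 := by simpa using hk
  refine ⟨_, hK.support_subset k ?_, (order_eq_orderTop_of_ne_zero h0).symm⟩
  rw [mem_support]
  exact mt coeff_order_eq_zero.1 h0

theorem mono_zero : mono hχ hK 0 = 1 := by
  refine LinearMap.ext fun b => HahnSeries.ext (funext fun δ => ?_)
  rw [coeff_mono, hχ.left_eq_one 0 N.zero_mem, sub_zero, one_mul]
  rfl

theorem exists_mono_mul_mono (γ δ : Γ) : ∃ k : K,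
    algebraMap K (HahnSeries Γ L) k = single 0 (χ γ δ) ∧
    mono hχ hK γ * mono hχ hK δ = k • mono hχ hK (γ + δ) := by
  obtain ⟨k, hk⟩ := hK.exists_single 0 N.zero_mem (χ γ δ)
  refine ⟨k, hk, LinearMap.ext fun b => HahnSeries.ext (funext fun ε => ?_)⟩
  rw [LinearMap.smul_apply, Algebra.smul_def, hk, coeff_single_mul, sub_zero, Module.End.mul_apply,
    coeff_mono, coeff_mono, coeff_mono, hχ.add_left]
  have h : ε - γ = δ + (ε - (γ + δ)) := by abel
  rw [h, hχ.add_right, add_sub_cancel_left]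
  ring

theorem exists_mono_add (γ : Γ) {n : Γ} (hn : n ∈ N) : ∃ k : K, k ≠ 0 ∧
    mono hχ hK (γ + n) = k • mono hχ hK γ := by
  obtain ⟨k, hk⟩ := hK.exists_single n hn 1
  refine ⟨k, ?_, LinearMap.ext fun b => HahnSeries.ext (funext fun ε => ?_)⟩
  · rintro rfl
    rw [map_zero, eq_comm, single_eq_zero_iff] at hk
    exact one_ne_zero hk
  · rw [LinearMap.smul_apply, Algebra.smul_def, hk, coeff_single_mul, one_mul, coeff_mono,
      coeff_mono, hχ.add_left, hχ.left_eq_one n hn, mul_one]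
    have h : ε - n - γ = ε - (γ + n) := by abel
    rw [h]

open Classical in
/-- A section of the quotient map, with value zero at zero. -/
noncomputable def sec (N : AddSubgroup Γ) (c : Γ ⧸ N) : Γ := if c = 0 then 0 else c.out

theorem sec_zero : sec N 0 = 0 := if_pos rfl

theorem mk_sec (c : Γ ⧸ N) : ((sec N c : Γ) : Γ ⧸ N) = c := by
  unfold sec
  split_ifs with h
  · rw [h]; rfl
  · exact QuotientAddGroup.out_eq' c

theorem exists_mono_eq_smul_sec (γ : Γ) {c : Γ ⧸ N} (hc : (γ : Γ ⧸ N) = c) : ∃ k : K, k ≠ 0 ∧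
    mono hχ hK γ = k • mono hχ hK (sec N c) := by
  have h : -sec N c + γ ∈ N := by
    rw [← QuotientAddGroup.eq, mk_sec, hc]
  simpa using exists_mono_add hχ hK (sec N c) h

/-- The twisted algebra spanned by the monomial operators. -/
noncomputable def alg : Subalgebra K (End K (HahnSeries Γ L)) :=
  (Submodule.span K (Set.range (mono hχ hK))).toSubalgebra
    (Submodule.subset_span ⟨0, mono_zero hχ hK⟩) fun x y hx hy => by
      refine Submodule.span_induction₂ (p := fun x y _ _ => x * y ∈ _) ?_ ?_ ?_ ?_ ?_ ?_ ?_ hx hy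
      · rintro _ _ ⟨c, rfl⟩ ⟨d, rfl⟩
        obtain ⟨k, -, hk⟩ := exists_mono_mul_mono hχ hK c d
        rw [hk]
        exact Submodule.smul_mem _ _ (Submodule.subset_span ⟨c + d, rfl⟩)
      · intro y _; rw [zero_mul]; exact zero_mem _
      · intro x _; rw [mul_zero]; exact zero_mem _
      · intro x y z _ _ _ h1 h2; rw [add_mul]; exact add_mem h1 h2
      · intro x y z _ _ _ h1 h2; rw [mul_add]; exact add_mem h1 h2
      · intro k x y _ _ h; rw [smul_mul_assoc]; exact Submodule.smul_mem _ _ h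
      · intro k x y _ _ h; rw [mul_smul_comm]; exact Submodule.smul_mem _ _ h

theorem mono_mem_alg (γ : Γ) : mono hχ hK γ ∈ alg hχ hK := Submodule.subset_span ⟨γ, rfl⟩

theorem mem_span_sec {f : End K (HahnSeries Γ L)} (hf : f ∈ alg hχ hK) :
    f ∈ Submodule.span K (Set.range fun c => mono hχ hK (sec N c)) := by
  refine (Submodule.span_le (p := Submodule.span K (Set.range fun c => mono hχ hK (sec N c)))).2 ?_ hf
  rintro _ ⟨γ, rfl⟩
  obtain ⟨k, -, hk⟩ := exists_mono_eq_smul_sec hχ hK γ rfl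
  rw [hk]
  exact Submodule.smul_mem _ _ (Submodule.subset_span ⟨_, rfl⟩)

theorem orderTop_smul_mono {k : K} {n γ : Γ}
    (hn : (algebraMap K (HahnSeries Γ L) k).orderTop = n) (b : HahnSeries Γ L) :
    ((k • mono hχ hK γ) b).orderTop = ((n + γ : Γ) : WithTop Γ) + b.orderTop := by
  rw [LinearMap.smul_apply, Algebra.smul_def, orderTop_mul, hn, orderTop_mono, WithTop.coe_add,
    add_assoc]

/-- A finite combination of monomial operators of distinct classes acts, to leading order, like one
of its terms. -/
theorem exists_leading {S : Finset (Γ ⧸ N)} (hS : S.Nonempty) {k : Γ ⧸ N → K}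
    (hk : ∀ c ∈ S, k c ≠ 0) : ∃ γ : Γ, ∃ l : L, ∀ b : HahnSeries Γ L, b ≠ 0 →
      ((∑ c ∈ S, k c • mono hχ hK (sec N c)) b).orderTop = γ + b.orderTop ∧
      ((∑ c ∈ S, k c • mono hχ hK (sec N c)) b).leadingCoeff =
        l * (χ γ b.order * b.leadingCoeff) := by
  choose! n hnN hn using fun c (hc : c ∈ S) => exists_order_mem hK (hk c hc)
  have hmk : ∀ c ∈ S, ((n c + sec N c : Γ) : Γ ⧸ N) = c := fun c hc => by
    rw [QuotientAddGroup.mk_add, (QuotientAddGroup.eq_zero_iff _).2 (hnN c hc), zero_add, mk_sec]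
  -- The term of least shift dominates whatever `b` is, since each operator shifts orders by a
  -- constant.
  obtain ⟨c, hc, hmin⟩ := S.exists_min_image (fun c => n c + sec N c) hS
  refine ⟨n c + sec N c, (algebraMap K (HahnSeries Γ L) (k c)).leadingCoeff, fun b hb => ?_⟩
  have hord := fun d hd => orderTop_smul_mono hχ hK (γ := sec N d) (hn d hd) b
  have hbT := order_eq_orderTop_of_ne_zero hb
  obtain ⟨d, hd, h1, h2, h3⟩ := exists_dominant_of_injOn
    (x := fun c => (k c • mono hχ hK (sec N c)) b) hS
    (fun c hc => by
      rw [← orderTop_ne_top, hord c hc, ← hbT, ← WithTop.coe_add]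
      exact WithTop.coe_ne_top)
    (fun c hc d hd h => by
      simp only [hord c hc, hord d hd, ← hbT, ← WithTop.coe_add, WithTop.coe_inj] at h
      rw [← hmk c hc, ← hmk d hd, add_right_cancel h])
  have hdc : d = c := by
    by_contra hdc
    have h4 := h3 c hc (Ne.symm hdc)
    rw [hord c hc, hord d hd, ← hbT, ← WithTop.coe_add, ← WithTop.coe_add, WithTop.coe_lt_coe] at h4
    exact absurd (lt_of_add_lt_add_right h4) (not_lt.2 (hmin d hd))
  subst hdc
  rw [LinearMap.sum_apply]
  refine ⟨by rw [h1, hord d hd], ?_⟩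
  rw [h2, LinearMap.smul_apply, Algebra.smul_def, leadingCoeff_mul, leadingCoeff_mono hχ hK _ hb,
    hχ.add_left, hχ.left_eq_one _ (hnN d hd), one_mul]

theorem exists_leading_of_mem {f : End K (HahnSeries Γ L)} (hf : f ∈ alg hχ hK) (h0 : f ≠ 0) :
    ∃ γ : Γ, ∃ l : L, ∀ b : HahnSeries Γ L, b ≠ 0 → (f b).orderTop = γ + b.orderTop ∧
      (f b).leadingCoeff = l * (χ γ b.order * b.leadingCoeff) := by
  obtain ⟨k, rfl⟩ := Finsupp.mem_span_range_iff_exists_finsupp.1 (mem_span_sec hχ hK hf)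
  refine exists_leading hχ hK ?_ fun c hc => Finsupp.mem_support_iff.1 hc
  rw [Finsupp.support_nonempty_iff]
  rintro rfl
  exact h0 Finsupp.sum_zero_index

theorem apply_ne_zero {f : End K (HahnSeries Γ L)} (hf : f ∈ alg hχ hK) (h0 : f ≠ 0)
    {b : HahnSeries Γ L} (hb : b ≠ 0) : f b ≠ 0 := by
  obtain ⟨γ, l, h⟩ := exists_leading_of_mem hχ hK hf h0
  rw [← orderTop_ne_top, (h b hb).1, ← order_eq_orderTop_of_ne_zero hb, ← WithTop.coe_add]
  exact WithTop.coe_ne_top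

/-- The shift in order caused by `f` is independent of `b`, hence is read off at `b = 1`. With `b =
g 1` this gives additivity of values on products. -/
theorem orderTop_apply {f : End K (HahnSeries Γ L)} (hf : f ∈ alg hχ hK) (b : HahnSeries Γ L) :
    (f b).orderTop = (f 1).orderTop + b.orderTop := by
  by_cases h0 : f = 0
  · simp [h0]
  by_cases hb : b = 0
  · simp [hb]
  obtain ⟨γ, l, h⟩ := exists_leading_of_mem hχ hK hf h0
  rw [(h b hb).1, (h 1 one_ne_zero).1, orderTop_one, add_zero]

theorem leadingCoeff_apply {f : End K (HahnSeries Γ L)} (hf : f ∈ alg hχ hK) (h0 : f ≠ 0)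
    {b : HahnSeries Γ L} (hb : b ≠ 0) :
    (f b).leadingCoeff = χ (f 1).order b.order * ((f 1).leadingCoeff * b.leadingCoeff) := by
  obtain ⟨γ, l, h⟩ := exists_leading_of_mem hχ hK hf h0
  have h1 := (h 1 one_ne_zero).1
  rw [orderTop_one, add_zero,
    ← order_eq_orderTop_of_ne_zero (apply_ne_zero hχ hK hf h0 one_ne_zero), WithTop.coe_inj] at h1
  rw [(h b hb).2, (h 1 one_ne_zero).2, h1, order_one, hχ.right_eq_one 0 N.zero_mem,
    leadingCoeff_one]
  ring

theorem linearIndependent_mono_sec :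
    LinearIndependent K fun c : Γ ⧸ N =>
      (⟨mono hχ hK (sec N c), mono_mem_alg hχ hK _⟩ : alg hχ hK) := by
  classical
  refine LinearIndependent.of_comp (alg hχ hK).val.toLinearMap ?_
  rw [linearIndependent_iff']
  intro s g hg i hi
  by_contra hgi
  have hsum : ∑ j ∈ s with g j ≠ 0, g j • mono hχ hK (sec N j) = 0 := by
    rw [Finset.sum_filter_of_ne]
    · exact hg
    · rintro j - h h0
      exact h (by rw [h0, zero_smul])
  obtain ⟨γ, l, h⟩ := exists_leading hχ hK (S := s.filter fun j => g j ≠ 0) (k := g)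
    ⟨i, by simp [hi, hgi]⟩ (fun c hc => (Finset.mem_filter.1 hc).2)
  have h1 := (h 1 one_ne_zero).1
  rw [hsum, orderTop_one, LinearMap.zero_apply, orderTop_zero, add_zero] at h1
  exact WithTop.coe_ne_top h1.symm

/-- The basis of monomial operators. -/
noncomputable def algBasis : Basis (Γ ⧸ N) K (alg hχ hK) :=
  Basis.mk (linearIndependent_mono_sec hχ hK) (by
    rintro ⟨f, hf⟩ -
    have h := mem_span_sec hχ hK hf
    have hmap : Submodule.map (alg hχ hK).val.toLinearMap (Submodule.span K (Set.range
        fun c : Γ ⧸ N => (⟨mono hχ hK (sec N c), mono_mem_alg hχ hK _⟩ : alg hχ hK))) =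
        Submodule.span K (Set.range fun c => mono hχ hK (sec N c)) := by
      rw [Submodule.map_span, ← Set.range_comp]
      rfl
    rw [← hmap] at h
    obtain ⟨g, hg, hgf⟩ := h
    rwa [show (⟨f, hf⟩ : alg hχ hK) = g from Subtype.ext hgf.symm])

theorem coe_algBasis (c : Γ ⧸ N) : (algBasis hχ hK c : End K (HahnSeries Γ L)) =
    mono hχ hK (sec N c) := by
  rw [algBasis, Basis.mk_apply]

/-- The twisted algebra is modelled by evaluation of its operators at `1`. -/
noncomputable def model : TwistedModel Γ L K (alg hχ hK) N χ where
  ev :=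
    { toFun := fun f => (f : End K (HahnSeries Γ L)) 1
      map_zero' := rfl
      map_add' := fun _ _ => rfl }
  ev_injective := by
    rw [injective_iff_map_eq_zero]
    intro f hf
    by_contra h0
    exact apply_ne_zero hχ hK f.2 (by simpa using h0) one_ne_zero hf
  basis := algBasis hχ hK
  basis_zero := Subtype.ext (by rw [coe_algBasis, sec_zero, mono_zero]; rfl)
  basis_mul c d := by
    obtain ⟨k, -, hk⟩ := exists_mono_mul_mono hχ hK (sec N c) (sec N d)
    obtain ⟨l, -, hl⟩ := exists_mono_eq_smul_sec hχ hK (sec N c + sec N d) (c := c + d)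
      (by rw [QuotientAddGroup.mk_add, mk_sec, mk_sec])
    refine ⟨k * l, Subtype.ext ?_⟩
    change (algBasis hχ hK c : End K (HahnSeries Γ L)) * algBasis hχ hK d =
      (k * l) • (algBasis hχ hK (c + d) : End K (HahnSeries Γ L))
    rw [coe_algBasis, coe_algBasis, coe_algBasis, hk, hl, smul_smul]
  basis_mul_neg c := by
    refine Subtype.ext ?_
    change (algBasis hχ hK c : End K (HahnSeries Γ L)) * algBasis hχ hK (-c) =
      (algBasis hχ hK (-c) : End K (HahnSeries Γ L)) * algBasis hχ hK c
    rw [coe_algBasis, coe_algBasis]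
    obtain ⟨k, hk, hk'⟩ := exists_mono_mul_mono hχ hK (sec N c) (sec N (-c))
    obtain ⟨l, hl, hl'⟩ := exists_mono_mul_mono hχ hK (sec N (-c)) (sec N c)
    have hmem : sec N c + sec N (-c) ∈ N := by
      rw [← QuotientAddGroup.eq_zero_iff, QuotientAddGroup.mk_add, mk_sec, mk_sec, add_neg_cancel]
    have hkl : k = l := (algebraMap K (HahnSeries Γ L)).injective
      (by rw [hk, hl, hχ.comm_of_add_mem hmem])
    rw [hk', hl', hkl, add_comm]
  order_ev_smul_basis k hk c := by
    obtain ⟨n, hnN, hn⟩ := exists_order_mem hK hk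
    have h : ((k • mono hχ hK (sec N c)) 1).orderTop = ((n + sec N c : Γ) : WithTop Γ) := by
      rw [orderTop_smul_mono hχ hK hn, orderTop_one, add_zero]
    have h0 : (k • mono hχ hK (sec N c)) 1 ≠ 0 := by
      rw [← orderTop_ne_top, h]; exact WithTop.coe_ne_top
    rw [← order_eq_orderTop_of_ne_zero h0, WithTop.coe_inj] at h
    change ((((k • (algBasis hχ hK c : End K (HahnSeries Γ L))) 1).order : Γ) : Γ ⧸ N) = c
    rw [coe_algBasis, h, QuotientAddGroup.mk_add, (QuotientAddGroup.eq_zero_iff _).2 hnN, zero_add,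
      mk_sec]
  orderTop_ev_mul f g := orderTop_apply hχ hK f.2 _
  leadingCoeff_ev_mul f g hf hg := leadingCoeff_apply hχ hK f.2 (by simpa using hf)
    (apply_ne_zero hχ hK g.2 (by simpa using hg) one_ne_zero)

end HahnTwist

/-! ### The exponent group and its twist -/

/-- Finitely supported integer exponents, ordered lexicographically. -/
abbrev LexExp : Type := Lex (ℕ →₀ ℤ)

namespace LexExp

/-- The subgroup of exponents whose `i`-th coordinate is divisible by `p ^ i`. -/
def divisible (p : ℕ) : AddSubgroup LexExp where
  carrier := {γ | ∀ i, (p : ℤ) ^ i ∣ ofLex γ i}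
  zero_mem' _ := dvd_zero _
  add_mem' h h' i := dvd_add (h i) (h' i)
  neg_mem' h i := (dvd_neg).2 (h i)

theorem mem_divisible {p : ℕ} {γ : LexExp} : γ ∈ divisible p ↔ ∀ i, (p : ℤ) ^ i ∣ ofLex γ i :=
  Iff.rfl

/-- The exponent with a single nonzero coordinate. -/
noncomputable def single (i : ℕ) (a : ℤ) : LexExp := toLex (Finsupp.single i a)

theorem ofLex_single (i j : ℕ) (a : ℤ) : ofLex (single i a) j = if i = j then a else 0 := by
  simp [single, Finsupp.single_apply]

theorem single_mem_divisible {p i : ℕ} {a : ℤ} : single i a ∈ divisible p ↔ (p : ℤ) ^ i ∣ a := by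
  rw [mem_divisible]
  refine ⟨fun h => by simpa [ofLex_single] using h i, fun h j => ?_⟩
  rw [ofLex_single]
  split_ifs with hij
  · rwa [← hij]
  · exact dvd_zero _

theorem sum_single (γ : LexExp) : ∑ i ∈ (ofLex γ).support, single i (ofLex γ i) = γ := by
  have h := Finsupp.sum_single (ofLex γ)
  apply ofLex.injective
  conv_rhs => rw [← h]
  rw [Finsupp.sum]
  exact map_sum (ofLexAddEquiv (ℕ →₀ ℤ)) _ _

theorem exists_pow_smul_eq_zero {p : ℕ} (c : LexExp ⧸ divisible p) : ∃ k, p ^ k • c = 0 := by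
  induction c using QuotientAddGroup.induction_on with | H γ => ?_
  refine ⟨(ofLex γ).support.sup id, ?_⟩
  rw [← QuotientAddGroup.mk_nsmul, QuotientAddGroup.eq_zero_iff, mem_divisible]
  intro i
  change (p : ℤ) ^ i ∣ (p ^ (ofLex γ).support.sup id) • ofLex γ i
  by_cases hi : i ∈ (ofLex γ).support
  · rw [nsmul_eq_mul]
    push_cast
    exact Dvd.dvd.mul_right (pow_dvd_pow _ (Finset.le_sup (f := id) hi)) _
  · rw [Finsupp.notMem_support_iff.1 hi, smul_zero]
    exact dvd_zero _

theorem infinite_quotient {p : ℕ} (hp : p.Prime) : Infinite (LexExp ⧸ divisible p) := by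
  refine Infinite.of_injective
    -- Coordinate `0` is skipped, since its modulus is `p ^ 0 = 1`.
    (fun i : ℕ => ((single (i + 1) 1 : LexExp) : LexExp ⧸ divisible p)) fun i j hij => ?_
  by_contra hne
  rw [QuotientAddGroup.eq, mem_divisible] at hij
  have h := hij (i + 1)
  change (p : ℤ) ^ (i + 1) ∣ -ofLex (single (i + 1) 1) (i + 1) + ofLex (single (j + 1) 1) (i + 1) at h
  rw [ofLex_single, ofLex_single, if_pos rfl, if_neg (by omega), add_zero, Int.dvd_neg] at h
  have h2 : (p : ℤ) ∣ 1 := (dvd_pow_self _ (Nat.succ_ne_zero i)).trans h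
  exact hp.one_lt.ne' (by exact_mod_cast Int.eq_one_of_dvd_one (by positivity) h2)

section Twist

variable {L : Type*} [Field L] (ζ : ℕ → Lˣ)

/-- The bimultiplicative map with value `ζ i` at the `i + 1`-st and `i`-th unit exponents. -/
noncomputable def unitTwist (γ δ : LexExp) : Lˣ :=
  (ofLex δ).prod fun i d => ζ i ^ (ofLex γ (i + 1) * d)

theorem unitTwist_add_left (γ γ' δ : LexExp) :
    unitTwist ζ (γ + γ') δ = unitTwist ζ γ δ * unitTwist ζ γ' δ := by
  rw [unitTwist, unitTwist, unitTwist, ← Finsupp.prod_mul]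
  refine Finsupp.prod_congr fun i _ => ?_
  rw [← zpow_add, ← add_mul]
  rfl

theorem unitTwist_add_right (γ δ δ' : LexExp) :
    unitTwist ζ γ (δ + δ') = unitTwist ζ γ δ * unitTwist ζ γ δ' := by
  rw [unitTwist, unitTwist, unitTwist]
  exact Finsupp.prod_add_index' (fun i => by rw [mul_zero, zpow_zero])
    fun i a b => by rw [mul_add, zpow_add]

/-- The twist with values in the field. -/
noncomputable def twist (γ δ : LexExp) : L := unitTwist ζ γ δ

variable {ζ} {p : ℕ} (hζ : ∀ i, IsPrimitiveRoot (ζ i) (p ^ i))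

include hζ

theorem unitTwist_eq_one {γ δ : LexExp} (h : ∀ i, (p : ℤ) ^ i ∣ ofLex γ (i + 1) * ofLex δ i) :
    unitTwist ζ γ δ = 1 :=
  Finset.prod_eq_one fun i _ => (hζ i).zpow_eq_one_iff_dvd _ |>.2 (by exact_mod_cast h i)

theorem isTwist : IsTwist (divisible p) (twist ζ) where
  ne_zero γ δ := (unitTwist ζ γ δ).ne_zero
  add_left γ γ' δ := by simp only [twist, unitTwist_add_left, Units.val_mul]
  add_right γ δ δ' := by simp only [twist, unitTwist_add_right, Units.val_mul]
  left_eq_one n hn δ := by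
    rw [twist, unitTwist_eq_one hζ, Units.val_one]
    exact fun i => Dvd.dvd.mul_right ((pow_dvd_pow _ i.le_succ).trans (hn (i + 1))) _
  right_eq_one n hn γ := by
    rw [twist, unitTwist_eq_one hζ, Units.val_one]
    exact fun i => Dvd.dvd.mul_left (hn i) _

/-- Every nontrivial finite group of exponent classes is degenerate. -/
theorem exists_radical (hp : p.Prime) (S : AddSubgroup (LexExp ⧸ divisible p)) (hS : Finite S)
    (hne : S ≠ ⊥) : ∃ c ∈ S, c ≠ 0 ∧ ∀ γ δ : LexExp, (γ : LexExp ⧸ divisible p) = c →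
      (δ : LexExp ⧸ divisible p) ∈ S → twist ζ γ δ = twist ζ δ γ := by
  classical
  have hex : ∃ k, ∀ c ∈ S, p ^ k • c = 0 := by
    choose k hk using exists_pow_smul_eq_zero (p := p)
    have hfin : (S : Set (LexExp ⧸ divisible p)).Finite := Set.toFinite _
    refine ⟨hfin.toFinset.sup k, fun c hc => ?_⟩
    have hle : k c ≤ hfin.toFinset.sup k := Finset.le_sup (by simpa using hc)
    rw [← Nat.sub_add_cancel hle, _root_.pow_add, mul_smul, hk, smul_zero]
  obtain ⟨m, hm⟩ : ∃ m, Nat.find hex = m + 1 := by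
    refine Nat.exists_eq_succ_of_ne_zero fun h0 => hne ?_
    rw [eq_bot_iff]
    intro c hc
    simpa [h0] using Nat.find_spec hex c hc
  have hspec := Nat.find_spec hex
  rw [hm] at hspec
  have hmin : ¬ ∀ c ∈ S, p ^ m • c = 0 := Nat.find_min hex (by omega)
  push Not at hmin
  obtain ⟨x, hxS, hx⟩ := hmin
  -- The exponent of `S` is `p ^ (m + 1)`, and `p ^ m • x` is a nonzero multiple of `p ^ m`.
  refine ⟨p ^ m • x, S.nsmul_mem hxS _, hx, fun γ δ hγ hδ => ?_⟩
  induction x using QuotientAddGroup.induction_on with | H ξ => ?_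
  -- Cancel one `p` from `p ^ (i + 1) ∣ p ^ (m + 1) * η (i + 1)`. What remains is exactly the order
  -- of `ζ i`, so both twists below are trivial.
  have hdvd : ∀ η : LexExp, (η : LexExp ⧸ divisible p) ∈ S → ∀ i,
      (p : ℤ) ^ i ∣ (p : ℤ) ^ m * ofLex η (i + 1) := by
    intro η hη i
    have h := hspec _ hη
    rw [← QuotientAddGroup.mk_nsmul, QuotientAddGroup.eq_zero_iff, mem_divisible] at h
    have h1 : (p : ℤ) ^ (i + 1) ∣ (p ^ (m + 1)) • ofLex η (i + 1) := h (i + 1)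
    rw [nsmul_eq_mul, pow_succ', Nat.cast_pow, pow_succ', mul_assoc] at h1
    exact Int.dvd_of_mul_dvd_mul_left (by exact_mod_cast hp.ne_zero) h1
  obtain ⟨n, hn, rfl⟩ : ∃ n ∈ divisible p, γ = n + p ^ m • ξ := by
    refine ⟨γ - p ^ m • ξ, ?_, by abel⟩
    rw [← QuotientAddGroup.eq_zero_iff, QuotientAddGroup.mk_sub, hγ, QuotientAddGroup.mk_nsmul,
      sub_self]
  have hT := isTwist hζ
  rw [hT.add_left, hT.add_right, hT.left_eq_one n hn, hT.right_eq_one n hn, twist, twist,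
    unitTwist_eq_one hζ, unitTwist_eq_one hζ]
  · intro i
    change _ ∣ ofLex δ (i + 1) * ((p ^ m) • ofLex ξ i)
    rw [nsmul_eq_mul, Nat.cast_pow, mul_left_comm, ← mul_assoc]
    exact Dvd.dvd.mul_right (hdvd δ hδ i) _
  · intro i
    change _ ∣ ((p ^ m) • ofLex ξ (i + 1)) * ofLex δ i
    rw [nsmul_eq_mul, Nat.cast_pow]
    exact Dvd.dvd.mul_right (hdvd ξ hxS i) _

/-- The commutator pairing of the twist is nondegenerate. -/
theorem exists_twist_ne (c : LexExp ⧸ divisible p) (hc : c ≠ 0) :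
    ∃ d : LexExp ⧸ divisible p, ∀ γ δ : LexExp, (γ : LexExp ⧸ divisible p) = c →
      (δ : LexExp ⧸ divisible p) = d → twist ζ γ δ ≠ twist ζ δ γ := by
  classical
  have hT := isTwist hζ
  have key : ∀ γ : LexExp, γ ∉ divisible p → ∃ i, twist ζ γ (single i 1) ≠
      twist ζ (single i 1) γ := by
    intro γ hγ
    let T := (ofLex γ).support.filter fun i => ¬ (p : ℤ) ^ i ∣ ofLex γ i
    have hTne : T.Nonempty := by
      rw [mem_divisible] at hγ
      push Not at hγ
      obtain ⟨i, hi⟩ := hγ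
      refine ⟨i, Finset.mem_filter.2 ⟨Finsupp.mem_support_iff.2 fun h => hi ?_, hi⟩⟩
      rw [h]
      exact dvd_zero _
    -- Take the last nonzero coordinate modulo `N` and pair with the unit exponent at `i + 1`. The
    -- contribution of coordinate `i + 2` is trivial by maximality, leaving `ζ i ^ γ i ≠ 1`.
    obtain ⟨i, hi, hmax⟩ := T.exists_max_image id hTne
    have hbig : (p : ℤ) ^ (i + 2) ∣ ofLex γ (i + 2) := by
      by_contra h
      have : i + 2 ∈ T := Finset.mem_filter.2 ⟨Finsupp.mem_support_iff.2 fun h' => h (by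
        rw [h']; exact dvd_zero _), h⟩
      have := hmax _ this
      simp at this
    refine ⟨i + 1, fun h => ?_⟩
    have h1 : unitTwist ζ γ (single (i + 1) 1) = 1 := by
      refine unitTwist_eq_one hζ fun j => ?_
      rw [ofLex_single]
      split_ifs with hj
      · rw [← hj, mul_one]
        exact (pow_dvd_pow _ (Nat.le_succ _)).trans hbig
      · rw [mul_zero]; exact dvd_zero _
    have h2 : unitTwist ζ (single (i + 1) 1) γ = ζ i ^ ofLex γ i := by
      rw [unitTwist, Finsupp.prod, Finset.prod_eq_single i]
      · rw [ofLex_single, if_pos rfl, one_mul]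
      · intro j _ hj
        rw [ofLex_single, if_neg (by omega), zero_mul, zpow_zero]
      · intro h
        rw [Finsupp.notMem_support_iff.1 h, mul_zero, zpow_zero]
    rw [twist, twist, Units.val_inj, h1, h2, eq_comm, (hζ i).zpow_eq_one_iff_dvd] at h
    exact (Finset.mem_filter.1 hi).2 (by exact_mod_cast h)
  induction c using QuotientAddGroup.induction_on with | H γ => ?_
  rw [Ne, QuotientAddGroup.eq_zero_iff] at hc
  obtain ⟨i, hi⟩ := key γ hc
  refine ⟨(single i 1 : LexExp), fun γ' δ hγ' hδ => ?_⟩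
  have h1 : ∀ a b : LexExp, (a : LexExp ⧸ divisible p) = b → ∃ n ∈ divisible p, a = n + b :=
    fun a b h => ⟨a - b, by
      rw [← QuotientAddGroup.eq_zero_iff, QuotientAddGroup.mk_sub, h, sub_self], by abel⟩
  obtain ⟨n, hn, rfl⟩ := h1 _ _ hγ'
  obtain ⟨m, hm, rfl⟩ := h1 _ _ hδ
  rwa [hT.add_left, hT.left_eq_one n hn, one_mul, hT.add_right, hT.right_eq_one m hm, one_mul,
    hT.add_left, hT.left_eq_one m hm, one_mul, hT.add_right, hT.right_eq_one n hn, one_mul]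

end Twist

end LexExp

/-! ### Embedding the field in Hahn series -/

/-- Monomials in Hahn series with independent exponents are algebraically independent. -/
theorem HahnSeries.algebraicIndependent_single {Γ L ι : Type*} [AddCommGroup Γ] [LinearOrder Γ]
    [IsOrderedAddMonoid Γ] [Field L] (ν : ι → Γ)
    (hν : Function.Injective fun m : ι →₀ ℕ => m.sum fun i a => a • ν i) :
    AlgebraicIndependent L fun i => (single (ν i) (1 : L)) := by
  rw [algebraicIndependent_iff_injective_aeval, injective_iff_map_eq_zero]
  intro P hP
  have hmon : ∀ (m : ι →₀ ℕ) (l : L), MvPolynomial.aeval (fun i => single (ν i) (1 : L))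
      (MvPolynomial.monomial m l) = single (m.sum fun i a => a • ν i) l := by
    intro m l
    rw [MvPolynomial.aeval_monomial, ← C_eq_algebraMap]
    have : (m.prod fun i k => single (ν i) (1 : L) ^ k) =
        single (m.sum fun i a => a • ν i) (1 : L) := by
      classical
      induction m using Finsupp.induction_linear with
      | zero => simp
      | add f g hf hg =>
        rw [Finsupp.prod_add_index' (by simp) (fun _ _ _ => _root_.pow_add _ _ _), hf, hg,
          Finsupp.sum_add_index' (by simp) (by simp [add_smul]), single_mul_single, one_mul]
      | single i a => simp [single_pow]
    rw [this, C_apply, single_mul_single, zero_add, mul_one]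
  ext m
  have h := congrArg (fun x : HahnSeries Γ L => x.coeff (m.sum fun i a => a • ν i)) hP
  rw [MvPolynomial.as_sum P, map_sum] at h
  simp only [hmon, coeff_sum, coeff_zero] at h
  rw [MvPolynomial.coeff_zero, ← h]
  symm
  rw [Finset.sum_eq_single m]
  · rw [coeff_single_same]
  · intro m' _ hm'
    exact coeff_single_of_ne fun h' => hm' (hν h'.symm)
  · intro hm
    rw [coeff_single_same]
    simpa using hm

/-- A purely transcendental field extension embeds in Hahn series, by sending the variables to
monomials with independent exponents. -/
theorem HahnSeries.exists_ringHom_of_adjoin_eq_top {Γ L K ι : Type*} [AddCommGroup Γ]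
    [LinearOrder Γ] [IsOrderedAddMonoid Γ] [Field L] [Field K] [Algebra L K] {t : ι → K}
    (ht : AlgebraicIndependent L t) (htop : IntermediateField.adjoin L (Set.range t) = ⊤)
    (ν : ι → Γ) (hν : Function.Injective fun m : ι →₀ ℕ => m.sum fun i a => a • ν i) :
    ∃ φ : K →+* HahnSeries Γ L, (∀ l, φ (algebraMap L K l) = single 0 l) ∧
      ∀ i, φ (t i) = single (ν i) 1 := by
  have hind := HahnSeries.algebraicIndependent_single (L := L) ν hν
  rw [algebraicIndependent_iff_injective_aeval] at hind
  let e : FractionRing (MvPolynomial ι L) ≃ₐ[L] K :=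
    ht.aevalEquivField.trans ((IntermediateField.equivOfEq htop).trans IntermediateField.topEquiv)
  have he : ∀ P : MvPolynomial ι L, e (algebraMap _ _ P) = MvPolynomial.aeval t P := fun P =>
    ht.aevalEquivField_algebraMap_apply_coe P
  let g : MvPolynomial ι L →+* HahnSeries Γ L :=
    (MvPolynomial.aeval fun i => single (ν i) (1 : L)).toRingHom
  have hg : Function.Injective g := hind
  let φ₁ : FractionRing (MvPolynomial ι L) →+* HahnSeries Γ L := IsFractionRing.lift hg
  have hφ : ∀ P : MvPolynomial ι L, (φ₁.comp e.symm.toRingEquiv.toRingHom)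
      (MvPolynomial.aeval t P) = MvPolynomial.aeval (fun i => single (ν i) (1 : L)) P := by
    intro P
    rw [← he]
    change φ₁ (e.symm (e _)) = _
    rw [e.symm_apply_apply]
    exact IsFractionRing.lift_algebraMap hg P
  refine ⟨φ₁.comp e.symm.toRingEquiv.toRingHom, fun l => ?_, fun i => ?_⟩
  · have h := hφ (MvPolynomial.C l)
    rwa [MvPolynomial.aeval_C, MvPolynomial.aeval_C, ← C_eq_algebraMap, C_apply] at h
  · have h := hφ (MvPolynomial.X i)
    rwa [MvPolynomial.aeval_X, MvPolynomial.aeval_X] at h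

/-- A rational function field in countably many variables embeds in Hahn series, with the `i`-th
variable sent to the monomial of exponent `p ^ i` in the `i`-th coordinate. -/
theorem LexExp.exists_embedding {L K : Type*} [Field L] [Field K] [Algebra L K] {t : ℕ → K}
    (ht : AlgebraicIndependent L t) (htop : IntermediateField.adjoin L (Set.range t) = ⊤)
    {p : ℕ} (hp : p ≠ 0) : ∃ φ : K →+* HahnSeries LexExp L,
      (∀ l, φ (algebraMap L K l) = HahnSeries.single 0 l) ∧
      (∀ i, φ (t i) = HahnSeries.single (LexExp.single i ((p : ℤ) ^ i)) 1) ∧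
      ∀ k, (φ k).support ⊆ LexExp.divisible p := by
  -- The variables are first sent to series with exponents in the subgroup; extending the exponent
  -- group afterwards gives the support condition for all of `K`, inverses included.
  let ν : ℕ → LexExp.divisible p := fun i =>
    ⟨LexExp.single i ((p : ℤ) ^ i), LexExp.single_mem_divisible.2 dvd_rfl⟩
  have hν : Function.Injective fun m : ℕ →₀ ℕ => m.sum fun i a => a • ν i := by
    let ev : ℕ → LexExp.divisible p →+ ℤ := fun j =>
      { toFun := fun γ => ofLex (γ : LexExp) j
        map_zero' := rfl
        map_add' := fun _ _ => rfl }
    have hcoord : ∀ (m : ℕ →₀ ℕ) (j : ℕ),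
        ev j (m.sum fun i a => a • ν i) = (m j : ℤ) * (p : ℤ) ^ j := by
      intro m j
      have hν' : ∀ i, ev j (ν i) = if i = j then (p : ℤ) ^ i else 0 := fun i =>
        LexExp.ofLex_single i j _
      rw [map_finsuppSum, Finsupp.sum, Finset.sum_eq_single j]
      · rw [map_nsmul, hν', if_pos rfl, nsmul_eq_mul]
      · intro i _ hij
        rw [map_nsmul, hν', if_neg hij, smul_zero]
      · intro h
        rw [Finsupp.notMem_support_iff.1 h, zero_smul, map_zero]
    intro m m' h
    ext j
    have h2 := congrArg (ev j) h
    simp only [hcoord] at h2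
    exact_mod_cast mul_right_cancel₀ (pow_ne_zero j (by exact_mod_cast hp : (p : ℤ) ≠ 0)) h2
  obtain ⟨φ, h1, h2⟩ := HahnSeries.exists_ringHom_of_adjoin_eq_top ht htop ν hν
  let ι : HahnSeries (LexExp.divisible p) L →+* HahnSeries LexExp L :=
    embDomainRingHom (LexExp.divisible p).subtype Subtype.val_injective fun _ _ => Iff.rfl
  have hι : ∀ (n : LexExp.divisible p) (l : L),
      ι (HahnSeries.single n l) = HahnSeries.single (n : LexExp) l := fun n l => embDomain_single
  refine ⟨ι.comp φ, fun l => ?_, fun i => ?_, fun k => ?_⟩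
  · rw [RingHom.comp_apply, h1]
    exact hι _ _
  · rw [RingHom.comp_apply, h2]
    exact hι _ _
  · refine (support_embDomain_subset).trans ?_
    rintro _ ⟨n, -, rfl⟩
    exact n.2

/-- A field extension finite over a purely transcendental extension of infinite transcendence
degree is a rational function field in countably many variables over a subfield. -/
theorem exists_algebraicIndependent_nat {F E K : Type*} [Field F] [Field E] [Field K]
    [Algebra F E] [Algebra E K] [Algebra F K] [IsScalarTower F E K]
    (hpt : IsPurelyTranscendental F E) (htrdeg : Cardinal.aleph0 ≤ Algebra.trdeg F E)
    [FiniteDimensional E K] : ∃ (D : IntermediateField F K) (t : ℕ → K),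
      AlgebraicIndependent (algebraicClosure D K) t ∧
      IntermediateField.adjoin (algebraicClosure D K) (Set.range t) = ⊤ := by
  classical
  obtain ⟨s, hs, htop⟩ := hpt
  have hsinf : s.Infinite := by
    intro hfin
    have h1 : Algebra.IsAlgebraic (IntermediateField.adjoin F s) E :=
      ⟨fun e => isAlgebraic_algebraMap
        (⟨e, by rw [htop]; trivial⟩ : IntermediateField.adjoin F s)⟩
    rw [IntermediateField.isAlgebraic_adjoin_iff_top] at h1
    exact absurd (htrdeg.trans (Algebra.IsAlgebraic.trdeg_le_cardinalMk F s))
      (not_le.2 hfin.lt_aleph0)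
  let f : E →ₐ[F] K := IsScalarTower.toAlgHom F E K
  let b := Module.finBasis E K
  let C : Finset E := Finset.univ.biUnion fun j => (minpoly E (b j)).coeffs
  choose T hT using fun e : E => IntermediateField.exists_finset_of_mem_adjoin
    (show e ∈ IntermediateField.adjoin F s by rw [htop]; trivial)
  let s₀ : Finset E := C.biUnion T
  -- Choose countably many variables absent from the coefficients of the minimal polynomials of a
  -- basis of `K` over `E`. All other variables go into `D`, over which this basis is then
  -- algebraic.
  let v := (hsinf.sdiff s₀.finite_toSet).natEmbedding
  let u : ℕ → s := fun i => ⟨v i, (v i).2.1⟩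
  have hu : Function.Injective u := fun i j h =>
    v.injective (Subtype.ext (congrArg (fun y : s => (y : E)) h))
  have hind : AlgebraicIndependent F fun y : s => f y := hs.map' (f := f) f.injective
  let D := IntermediateField.adjoin F ((fun y : s => f y) '' (Set.range u)ᶜ)
  have ht : AlgebraicIndependent D fun i => f (u i) := by
    have h := hind.adjoin_of_disjoint (disjoint_compl_left (a := Set.range u))
    rw [← IntermediateField.algebraicIndependent_adjoin_iff] at h
    exact h.comp (fun i : ℕ => ⟨u i, i, rfl⟩) fun i j h => hu (congrArg Subtype.val h)
  have hCD : ∀ e ∈ C, f e ∈ D := by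
    intro e he
    have hle : IntermediateField.adjoin F (T e : Set E) ≤ D.comap f := by
      rw [IntermediateField.adjoin_le_iff]
      intro y hy
      refine IntermediateField.subset_adjoin F _ ⟨⟨y, (hT e).1 hy⟩, ?_, rfl⟩
      rintro ⟨i, hi⟩
      refine (v i).2.2 (Finset.mem_coe.2 (Finset.mem_biUnion.2 ⟨e, he, ?_⟩))
      rw [show ((v i : E)) = y from congrArg Subtype.val hi]
      exact hy
    exact hle (hT e).2
  have hb : ∀ j, b j ∈ algebraicClosure D K := by
    intro j
    rw [mem_algebraicClosure_iff]
    have hlift : (minpoly E (b j)).map (algebraMap E K) ∈ Polynomial.lifts (algebraMap D K) := by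
      rw [Polynomial.lifts_iff_coeff_lifts]
      intro n
      rw [Polynomial.coeff_map]
      by_cases h0 : (minpoly E (b j)).coeff n = 0
      · exact ⟨0, by rw [h0, map_zero, map_zero]⟩
      · exact ⟨⟨_, hCD _ (Finset.mem_biUnion.2 ⟨j, Finset.mem_univ _,
          Polynomial.coeff_mem_coeffs h0⟩)⟩, rfl⟩
    obtain ⟨q, hq⟩ := (Polynomial.mem_lifts _).1 hlift
    refine ⟨q, ?_, ?_⟩
    · rintro rfl
      rw [Polynomial.map_zero, eq_comm, Polynomial.map_eq_zero] at hq
      exact minpoly.ne_zero (Algebra.IsIntegral.isIntegral (R := E) (b j)) hq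
    · rw [Polynomial.aeval_def, ← Polynomial.eval_map, hq, Polynomial.eval_map,
        ← Polynomial.aeval_def, minpoly.aeval]
  -- Independence survives passage to the algebraic closure of `D` in `K`. That closure contains the
  -- basis, so with the chosen variables it generates `K`.
  refine ⟨D, fun i => f (u i), ht.algebraicClosure, ?_⟩
  set Z := IntermediateField.adjoin (algebraicClosure D K) (Set.range fun i => f (u i)) with hZ
  have hLZ : ∀ y ∈ algebraicClosure D K, y ∈ Z := fun y hy => Z.algebraMap_mem ⟨y, hy⟩
  have hDZ : ∀ y ∈ D, y ∈ Z := fun y hy =>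
    hLZ y ((algebraicClosure D K).algebraMap_mem ⟨y, hy⟩)
  have hE : ∀ e : E, f e ∈ Z := by
    intro e
    have he : e ∈ IntermediateField.adjoin F s := by rw [htop]; trivial
    induction he using IntermediateField.adjoin_induction with
    | mem y hy =>
      by_cases h : (⟨y, hy⟩ : s) ∈ Set.range u
      · obtain ⟨i, hi⟩ := h
        refine IntermediateField.subset_adjoin _ _ ⟨i, ?_⟩
        change f (u i) = f y
        rw [hi]
      · exact hDZ _ (IntermediateField.subset_adjoin F _ ⟨⟨y, hy⟩, h, rfl⟩)
    | algebraMap y =>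
      rw [AlgHom.commutes]
      exact hDZ _ (D.algebraMap_mem y)
    | add x y _ _ hx hy => rw [map_add]; exact Z.add_mem hx hy
    | inv x _ hx => rw [map_inv₀]; exact Z.inv_mem hx
    | mul x y _ _ hx hy => rw [map_mul]; exact Z.mul_mem hx hy
  rw [eq_top_iff]
  intro y _
  rw [← b.sum_repr y]
  refine Z.sum_mem fun j _ => ?_
  rw [Algebra.smul_def]
  exact Z.mul_mem (hE _) (hLZ _ (hb j))

/-- The exponents whose monomials come from `K` form a group containing `p ^ i` times each unit
exponent, and these generate `divisible p`. -/
theorem LexExp.isMonomialField {L K : Type*} [Field L] [Field K] [Algebra L K]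
    [Algebra K (HahnSeries LexExp L)] {t : ℕ → K} {p : ℕ}
    (hL : ∀ l, algebraMap K (HahnSeries LexExp L) (algebraMap L K l) = HahnSeries.single 0 l)
    (ht : ∀ i, algebraMap K (HahnSeries LexExp L) (t i) =
      HahnSeries.single (LexExp.single i ((p : ℤ) ^ i)) 1)
    (hsupp : ∀ k, (algebraMap K (HahnSeries LexExp L) k).support ⊆ LexExp.divisible p) :
    IsMonomialField LexExp L K (LexExp.divisible p) where
  support_subset := hsupp
  exists_single n hn l := by
    let Q : AddSubgroup LexExp :=
      { carrier := {γ | ∃ k : K, algebraMap K (HahnSeries LexExp L) k = HahnSeries.single γ 1}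
        zero_mem' := ⟨1, map_one _⟩
        add_mem' := by
          rintro _ _ ⟨k, hk⟩ ⟨k', hk'⟩
          exact ⟨k * k', by rw [map_mul, hk, hk', single_mul_single, one_mul]⟩
        neg_mem' := by
          rintro _ ⟨k, hk⟩
          exact ⟨k⁻¹, by rw [map_inv₀, hk, inv_single, inv_one]⟩ }
    have hQ : n ∈ Q := by
      rw [← LexExp.sum_single n]
      refine sum_mem fun i _ => ?_
      obtain ⟨a, ha⟩ := hn i
      have : LexExp.single i (ofLex n i) = a • LexExp.single i ((p : ℤ) ^ i) := by
        rw [ha, mul_comm]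
        exact (Finsupp.smul_single a i ((p : ℤ) ^ i)).symm
      rw [this]
      exact Q.zsmul_mem ⟨t i, ht i⟩ a
    obtain ⟨k, hk⟩ := hQ
    exact ⟨algebraMap L K l * k, by rw [map_mul, hL, hk, single_mul_single, zero_add, mul_one]⟩

/-! ### Assembly of the division algebra -/

theorem exists_isPrimitiveRoot_units {F L : Type*} [Field F] [IsAlgClosed F] [Field L]
    [Algebra F L] {n : ℕ} (hn : (n : F) ≠ 0) : ∃ ζ : Lˣ, IsPrimitiveRoot ζ n := by
  have : NeZero (n : F) := ⟨hn⟩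
  obtain ⟨ζ, hζ⟩ := HasEnoughRootsOfUnity.exists_primitiveRoot F n
  exact ⟨_, (hζ.map_of_injective (algebraMap F L).injective).isUnit_unit
    fun h => hn (by rw [h, Nat.cast_zero])⟩

theorem TwistedModel.exists_divisionRing {L : Type*} {K R : Type w} [Field L] [Field K] [Ring R]
    [Algebra K R] {p : ℕ} (hp : p.Prime) (hpL : (p : L) ≠ 0) {ζ : ℕ → Lˣ}
    (hζ : ∀ i, IsPrimitiveRoot (ζ i) (p ^ i))
    (M : TwistedModel LexExp L K R (LexExp.divisible p) (LexExp.twist ζ)) :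
    ∃ (R : Type w) (_ : DivisionRing R) (_ : Algebra K R),
      Algebra.IsCentral K R ∧
      IsLFDAlgebra K R ∧
      Module.rank K R = Cardinal.aleph0 ∧
      (∀ A : Subalgebra K R, FiniteDimensional K A → ∃ n : ℕ, Module.finrank K A = p ^ n) ∧
      (∀ A : Subalgebra K R, FiniteDimensional K A → Algebra.IsCentral K A → A = ⊥) ∧
      ¬ IsNLFAlgebra K R := by
  have htors := LexExp.exists_pow_smul_eq_zero (p := p)
  have hpow : ∀ A : Subalgebra K (R), FiniteDimensional K A →
      ∃ n : ℕ, Module.finrank K A = p ^ n := fun A _ => M.exists_finrank_eq_pow hp htors A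
  have hbot : ∀ A : Subalgebra K (R), FiniteDimensional K A →
      Algebra.IsCentral K A → A = ⊥ := fun A hA hc => by
    obtain ⟨n, hn⟩ := hpow A hA
    refine M.eq_bot_of_isCentral (LexExp.exists_radical hζ hp) A ?_ hc
    rw [hn, Nat.cast_pow]
    exact pow_ne_zero n hpL
  have hinf := LexExp.infinite_quotient hp
  have hrank : Module.rank K (R) = Cardinal.aleph0 := by
    have : Countable LexExp := inferInstanceAs (Countable (ℕ →₀ ℤ))
    have : Countable (LexExp ⧸ LexExp.divisible p) := Quotient.countable
    have h := M.basis.mk_eq_rank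
    rwa [Cardinal.mk_eq_aleph0, Cardinal.lift_aleph0, eq_comm, Cardinal.lift_eq_aleph0] at h
  refine ⟨R,
    (have := M.nontrivial; DivisionRing.ofIsUnitOrEqZero fun a =>
      (ne_or_eq a 0).imp_left fun ha => M.isUnit_of_ne_zero hp htors ha),
    inferInstance, M.isCentral (LexExp.exists_twist_ne hζ), M.isLFD hp htors, hrank, hpow, hbot, ?_⟩
  intro hNLF
  have : Nontrivial (LexExp ⧸ LexExp.divisible p) := Infinite.instNontrivial _
  -- A central finite-dimensional subalgebra containing `basis c` would equal `K`, forcing the class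
  -- `c` to vanish.
  obtain ⟨c, hc⟩ := exists_ne (0 : LexExp ⧸ LexExp.divisible p)
  obtain ⟨B, hB, hfin, hcent⟩ := hNLF {M.basis c}
  have hmem : M.basis c ∈ B := hB (by simp)
  rw [hbot B hfin hcent] at hmem
  obtain ⟨k, hk⟩ := Algebra.mem_bot.1 hmem
  have hk0 : k ≠ 0 := by
    rintro rfl
    rw [map_zero] at hk
    exact M.basis.ne_zero c hk.symm
  apply hc
  rw [← M.cls_smul_basis one_ne_zero c, one_smul, ← hk, M.cls_algebraMap hk0]

theorem theorem2p1
    (K₀ : Type u) (Kinf : Type v) (K : Type w) [Field K₀] [Field Kinf] [Field K]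
    [Algebra K₀ Kinf] [Algebra Kinf K]
    [IsAlgClosed K₀]
    (hpt : IsPurelyTranscendental K₀ Kinf)
    (htrdeg : Cardinal.aleph0 ≤ Algebra.trdeg K₀ Kinf)
    [FiniteDimensional Kinf K]
    (p : ℕ) (hp : p.Prime) (hpchar : p ≠ ringChar K₀) :
    ∃ (R : Type w) (_ : DivisionRing R) (_ : Algebra K R),
      Algebra.IsCentral K R ∧
      IsLFDAlgebra K R ∧
      Module.rank K R = Cardinal.aleph0 ∧
      (∀ A : Subalgebra K R, FiniteDimensional K A → ∃ n : ℕ, Module.finrank K A = p ^ n) ∧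
      (∀ A : Subalgebra K R, FiniteDimensional K A → Algebra.IsCentral K A → A = ⊥) ∧
      ¬ IsNLFAlgebra K R := by
  let : Algebra K₀ K := ((algebraMap Kinf K).comp (algebraMap K₀ Kinf)).toAlgebra
  have : IsScalarTower K₀ Kinf K := IsScalarTower.of_algebraMap_eq fun _ => rfl
  obtain ⟨D, t, ht, htop⟩ := exists_algebraicIndependent_nat (K := K) hpt htrdeg
  let L := algebraicClosure D K
  have hpK : (p : K₀) ≠ 0 := fun h => by
    rcases hp.eq_one_or_self_of_dvd _ ((ringChar.spec K₀ p).1 h) with h1 | h1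
    · exact CharP.ringChar_ne_one h1
    · exact hpchar h1.symm
  have hpL : (p : L) ≠ 0 := fun h => hpK ((algebraMap K₀ L).injective
    (by rw [map_natCast, h, map_zero]))
  choose ζ hζ using fun i : ℕ => exists_isPrimitiveRoot_units (F := K₀) (L := L) (n := p ^ i)
    (by rw [Nat.cast_pow]; exact pow_ne_zero i hpK)
  obtain ⟨φ, hφL, hφt, hφs⟩ := LexExp.exists_embedding ht htop hp.ne_zero
  let : Algebra K (HahnSeries LexExp L) := φ.toAlgebra
  exact (HahnTwist.model (LexExp.isTwist hζ)
    (LexExp.isMonomialField hφL hφt hφs)).exists_divisionRing hp hpL hζ
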